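/- Let $d\ge 1$ and $s_0=(2d)^{-2d}$. There is a constant $c=c(d)>0$, depending only on $d$, such that the following holds for every convex polytope $P\subset\mathbb R^d$ of volume $V(P)=1$. For $z\in P$ let $v(z)=\min\{V(P\cap H): H \text{ a closed half-space},\ z\in H\}$, let $P(v\ge t)=\{z\in P: v(z)\ge t\}$, and let $P(v=s)=\partial P(v\ge s)$. For $z \in P$ and $\lambda>0$ let $M(z,\lambda)=z+\lambda[(P-z)\cap(z-P)]$ be the Macbeath region. A saturated system on $P(v=s)$ is a maximal (with respect to inclusion) set of points of $P(v=s)$ whose regions $M(\cdot,\tfrac12)$ are pairwise disjoint. A cap of $P$ is a set $P\cap\{x: u\cdot x\ge h_P(u)-t\}$ with $|u|=1$ and $t\ge0$, where $h_P(u)=\max_{x\in P}u\cdot x$. For a point $z$ of $P$ let $S(z,T)=\{x\in P:[x,z]\cap P(v\ge T)=\varnothing\}$. Let $F(P)$ be the number of flags of $P$, i.e. of sequences of faces $F_0\subset F_1\subset\dots\subset F_{d-1}$ of $P$ with $\dim F_i=i$. Let $0<s\le s_0$ and $2s\le T$, and let $Z(s)$ be any saturated system on $P(v=s)$. Then: (i)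 if $C$ is a cap of $P$ with $V(C)=T$, then $Z(s)\cap C$ is finite and $$|Z(s)\cap C|\le c\,F(P)\,\ln^{d-1}\!\left(\frac Ts\right);$$ (ii) if $z\in P(v=s)$, then $Z(s)\cap S(z,T)$ is finite and $$|Z(s)\cap S(z,T)|\le c\,F(P)\,\ln^{d-1}\!\left(\frac Ts\right).$$ -/

import Mathlib

open scoped RealInnerProductSpace

namespace PolytopeCaps

noncomputable section

/-- A convex polytope in `ℝ^d`: the convex hull of finitely many points. -/
def IsPolytope {d : ℕ} (P : Set (EuclideanSpace ℝ (Fin d))) : Prop :=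
  ∃ A : Set (EuclideanSpace ℝ (Fin d)), A.Finite ∧ P = convexHull ℝ A

/-- `F` is a nonempty face of `P` of affine dimension `k`. Faces are the subsets of `P` on which
some linear functional attains its maximum over `P`. -/
def IsFaceOfDim {d : ℕ} (P : Set (EuclideanSpace ℝ (Fin d))) (k : ℕ)
    (F : Set (EuclideanSpace ℝ (Fin d))) : Prop :=
  F.Nonempty ∧ IsExposed ℝ P F ∧ Module.finrank ℝ (affineSpan ℝ F).direction = k

/-- A flag of `P`: faces `F 0 ⊆ F 1 ⊆ ⋯ ⊆ F (d - 1)` of `P` with `dim (F i) = i`. -/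
def IsFlag {d : ℕ} (P : Set (EuclideanSpace ℝ (Fin d)))
    (F : Fin d → Set (EuclideanSpace ℝ (Fin d))) : Prop :=
  (∀ i : Fin d, IsFaceOfDim P (i : ℕ) (F i)) ∧ Monotone F

/-- The number of flags of `P`. -/
def numFlags {d : ℕ} (P : Set (EuclideanSpace ℝ (Fin d))) : ℕ :=
  {F : Fin d → Set (EuclideanSpace ℝ (Fin d)) | IsFlag P F}.ncard

/-- The support function `h_K(u) = max {⟪u, x⟫ : x ∈ K}`. -/
def supportFn {d : ℕ} (K : Set (EuclideanSpace ℝ (Fin d))) (u : EuclideanSpace ℝ (Fin d)) : ℝ :=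
  sSup ((fun x => ⟪u, x⟫) '' K)

/-- `C` is a cap of `K`, that is, `C = K ∩ {x : ⟪u, x⟫ ≥ h_K(u) - t}` for a unit vector `u`
and some `t ≥ 0`. -/
def IsCap {d : ℕ} (K C : Set (EuclideanSpace ℝ (Fin d))) : Prop :=
  ∃ u : EuclideanSpace ℝ (Fin d), ‖u‖ = 1 ∧ ∃ t : ℝ, 0 ≤ t ∧
    C = K ∩ {x | supportFn K u - t ≤ ⟪u, x⟫}

/-- `v(z) = min {V(K ∩ H) : H a closed half-space containing z}`. -/
def minCapVol {d : ℕ} (K : Set (EuclideanSpace ℝ (Fin d)))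
    (z : EuclideanSpace ℝ (Fin d)) : ℝ :=
  sInf {r : ℝ | ∃ u : EuclideanSpace ℝ (Fin d), ‖u‖ = 1 ∧ ∃ a : ℝ, a ≤ ⟪u, z⟫ ∧
    r = MeasureTheory.volume.real (K ∩ {x | a ≤ ⟪u, x⟫})}

/-- The floating body `K(v ≥ t)`. -/
def floatingBody {d : ℕ} (K : Set (EuclideanSpace ℝ (Fin d))) (t : ℝ) :
    Set (EuclideanSpace ℝ (Fin d)) :=
  {z | z ∈ K ∧ t ≤ minCapVol K z}

/-- The set `K(v = s)`, defined as the boundary of the floating body `K(v ≥ s)`. -/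
def levelSet {d : ℕ} (K : Set (EuclideanSpace ℝ (Fin d))) (s : ℝ) :
    Set (EuclideanSpace ℝ (Fin d)) :=
  frontier (floatingBody K s)

/-- The Macbeath region `M(z, r) = z + r [(K - z) ∩ (z - K)]`. -/
def macbeath {d : ℕ} (K : Set (EuclideanSpace ℝ (Fin d))) (z : EuclideanSpace ℝ (Fin d))
    (r : ℝ) : Set (EuclideanSpace ℝ (Fin d)) :=
  (fun w => z + r • w) '' {w | z + w ∈ K ∧ z - w ∈ K}

/-- `Z` is a saturated system on `K(v = s)`: a set of points of `K(v = s)` with pairwise disjoint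
Macbeath regions `M(z, 1/2)` that is maximal under inclusion among such sets. -/
def IsSaturated {d : ℕ} (K : Set (EuclideanSpace ℝ (Fin d))) (s : ℝ)
    (Z : Set (EuclideanSpace ℝ (Fin d))) : Prop :=
  Maximal (fun Y : Set (EuclideanSpace ℝ (Fin d)) =>
    Y ⊆ levelSet K s ∧ Y.PairwiseDisjoint (fun z => macbeath K z (1 / 2))) Z

/-- `S(z, T)`: the points of `K` visible from `z` within `K(v < T)`. -/
def visibleRegion {d : ℕ} (K : Set (EuclideanSpace ℝ (Fin d))) (z : EuclideanSpace ℝ (Fin d))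
    (T : ℝ) : Set (EuclideanSpace ℝ (Fin d)) :=
  {x | x ∈ K ∧ segment ℝ x z ∩ floatingBody K T = ∅}

/-- The threshold `s₀ = (2d)^{-2d}`. -/
def sZero (d : ℕ) : ℝ := ((2 * (d : ℝ)) ^ (2 * d))⁻¹

end

end PolytopeCaps

/-!
The proof compares volumes. Call `symCore P z = (P - z) ∩ (z - P)` the symmetric core, so that the
Macbeath region `M(z, 1)` is `z + symCore P z`, and write `v` for `minCapVol P`.

*Macbeath regions.* A half-space through `z` contains half of `M(z, 1)`, so `V(M(z, 1)) ≤ 2 v(z)`.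
Conversely `v(z) ≤ c V(M(z, 1))` (`macbeathConst_mul_minCapVol_le`), because a nearly minimal cap
at `z`, reflected in `z` and shrunk, stays in `P` (`sub_smul_mem_of_mem_lowerCap`): otherwise
tilting the cap would produce a much smaller one. On the level set `P(v = s)` one has
`s ≤ v ≤ c s`. So the regions `M(z, 1/2)` of a disjoint system have volume at least `c s` and
consist of points `x` with `V(M(x, 1)) ≤ c' s`, and the number of centres `z` in a cap `C` is at
most `(c s)⁻¹` times the volume of `{x : V(M(x, 1)) ≤ c' s}` inside the doubled cap.

*Flag simplices.* Helly's theorem gives each face `G` a central point `b G`, with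
`b G + (b G - y) / d ∈ G` for all `y ∈ G` (`exists_central_point`). Projecting successively from
central points to relative boundaries of faces covers `P`, up to a null set, by the simplices with
vertices `b F₀, …, b F_{d-1}, b P`, one for each flag (`volume_diff_iUnion_flagSimplex`). In such
a simplex, with coordinates `x = b₀ + ∑ λᵢ (bᵢ - b₀)` and `D` the volume of the parallelepiped
spanned by the `bᵢ - b₀`, centrality yields `V(M(x, 1)) ≥ c D ∏ λᵢ`. It also confines a cap of
volume `T` to a box `λᵢ ≤ aᵢ ≤ 1` with `D ∏ aᵢ ≤ c T`. After rescaling by the `aᵢ`, what remains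
is the volume of `{ν ∈ [0,1]^d : ∏ νᵢ ≤ τ}`, which is at most `e τ (1 + log (1/τ))^(d-1)`
(`volume_real_hyperbolicRegion_le`). Summing over the flags gives the bound for caps.

*Visible regions.* If `x` is visible from `z ∈ P(v = s)`, then the midpoint `w` of `[x, z]` has
`v(w) < T`. Its Macbeath region contains a copy of `M(z, 1)` sheared along `x - z`, with
determinant proportional to the height of `x` measured in heights of a nearly minimal cap at `z`
(`apply_le_of_mem_visibleRegion`). Hence `S(z, T)` lies in the cap of `z` widened by a factor
`c T / s`. The volume of that cap is at most `s` times a power of `c T / s`, and the bound for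
caps applies, the power only affecting the constant in front of the logarithm.
-/

open scoped RealInnerProductSpace
open MeasureTheory Set

namespace PolytopeCaps

section

variable {d : ℕ}

local notation "𝔼" => EuclideanSpace ℝ (Fin d)

/-! ### Volumes of affine images -/

theorem volume_real_image_affine (f : 𝔼 →ₗ[ℝ] 𝔼) (v : 𝔼) (s : Set 𝔼) :
    volume.real ((fun y => v + f y) '' s) = |LinearMap.det f| * volume.real s := by
  have h : (fun y => v + f y) '' s = (fun y => v + y) '' (f '' s) := by
    rw [image_image]
  rw [h, image_add_left, Measure.real, measure_preimage_add, Measure.addHaar_image_linearMap,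
    ENNReal.toReal_mul, ENNReal.toReal_ofReal (abs_nonneg _)]
  rfl

theorem volume_real_image_homothety (r : ℝ) (v : 𝔼) (s : Set 𝔼) :
    volume.real ((fun y => v + r • y) '' s) = |r| ^ d * volume.real s := by
  have := volume_real_image_affine (r • (LinearMap.id : 𝔼 →ₗ[ℝ] 𝔼)) v s
  simpa [LinearMap.det_smul, abs_pow] using this

theorem volume_real_image_shear (r : ℝ) (m : 𝔼 →L[ℝ] ℝ) (w v : 𝔼) (s : Set 𝔼) :
    volume.real ((fun y => v + r • (y + m y • w)) '' s) =
      |r| ^ d * |1 + m w| * volume.real s := by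
  have := volume_real_image_affine
    (r • (LinearMap.transvection (m : 𝔼 →ₗ[ℝ] ℝ) w : 𝔼 →ₗ[ℝ] 𝔼)) v s
  simpa [LinearMap.det_smul, abs_pow, abs_mul, LinearMap.transvection.apply] using this

/-! ### Caps, symmetric cores and the function `minCapVol` -/

/-- The translated Macbeath region `(K - z) ∩ (z - K)`, centred at the origin. -/
def symCore (K : Set 𝔼) (z : 𝔼) : Set 𝔼 := {w | z + w ∈ K ∧ z - w ∈ K}

/-- The part of `K` where the functional `ψ` exceeds its value at `p` by at most `t`. It is a cap of
width proportional to `t` when `ψ` attains its minimum over `K` at `p`. -/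
def lowerCap (K : Set 𝔼) (ψ : 𝔼 →L[ℝ] ℝ) (p : 𝔼) (t : ℝ) : Set 𝔼 := {x ∈ K | ψ x ≤ ψ p + t}

theorem volume_real_macbeath (K : Set 𝔼) (z : 𝔼) (r : ℝ) :
    volume.real (macbeath K z r) = |r| ^ d * volume.real (symCore K z) :=
  volume_real_image_homothety r z _

theorem isClosed_symCore {K : Set 𝔼} (hK : IsClosed K) (z : 𝔼) : IsClosed (symCore K z) :=
  (hK.preimage (by fun_prop : Continuous fun w : 𝔼 => z + w)).inter
    (hK.preimage (by fun_prop : Continuous fun w : 𝔼 => z - w))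

theorem isCompact_symCore {K : Set 𝔼} (hK : IsCompact K) (z : 𝔼) : IsCompact (symCore K z) := by
  refine (hK.image (by fun_prop : Continuous fun y : 𝔼 => y - z)).of_isClosed_subset
    (isClosed_symCore hK.isClosed z) ?_
  rintro w ⟨hw, -⟩
  exact ⟨_, hw, by simp⟩

theorem measurableSet_macbeath {K : Set 𝔼} (hK : IsCompact K) (z : 𝔼) (r : ℝ) :
    MeasurableSet (macbeath K z r) := by
  exact ((isCompact_symCore hK z).image
    (by fun_prop : Continuous fun w : 𝔼 => z + r • w)).measurableSet

theorem smul_mem_symCore {K : Set 𝔼} (hK : Convex ℝ K) {z w : 𝔼} (hw : w ∈ symCore K z) {r : ℝ}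
    (hr : |r| ≤ 1) : r • w ∈ symCore K z := by
  obtain ⟨h1, h2⟩ := hw
  rw [abs_le] at hr
  have key : ∀ q : ℝ, -1 ≤ q → q ≤ 1 → z + q • w ∈ K := by
    intro q hq1 hq2
    have := hK h1 h2 (show 0 ≤ (1 + q) / 2 by linarith) (show 0 ≤ (1 - q) / 2 by linarith) (by ring)
    convert this using 1
    module
  refine ⟨key r hr.1 hr.2, ?_⟩
  have := key (-r) (by linarith) (by linarith)
  rwa [neg_smul, ← sub_eq_add_neg] at this

theorem mem_of_mem_symCore {K : Set 𝔼} (hK : Convex ℝ K) {z w : 𝔼} (hw : w ∈ symCore K z) :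
    z ∈ K := by
  have := (smul_mem_symCore hK hw (r := 0) (by simp)).1
  simpa using this

theorem isCompact_lowerCap {K : Set 𝔼} (hK : IsCompact K) (ψ : 𝔼 →L[ℝ] ℝ) (p : 𝔼) (t : ℝ) :
    IsCompact (lowerCap K ψ p t) :=
  hK.inter_right (isClosed_le ψ.continuous continuous_const)

theorem volume_lowerCap_ne_top {K : Set 𝔼} (hK : IsCompact K) (ψ : 𝔼 →L[ℝ] ℝ) (p : 𝔼) (t : ℝ) :
    volume (lowerCap K ψ p t) ≠ ⊤ :=
  ((isCompact_lowerCap hK ψ p t).measure_lt_top (μ := volume)).ne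

theorem minCapVol_le_lowerCap {K : Set 𝔼} (hd : 1 ≤ d) (hK : IsCompact K) (ψ : 𝔼 →L[ℝ] ℝ)
    {p z : 𝔼} {t : ℝ} (hz : ψ z ≤ ψ p + t) :
    minCapVol K z ≤ volume.real (lowerCap K ψ p t) := by
  have hbdd : BddBelow {r : ℝ | ∃ u : 𝔼, ‖u‖ = 1 ∧ ∃ a : ℝ, a ≤ ⟪u, z⟫ ∧
      r = volume.real (K ∩ {x | a ≤ ⟪u, x⟫})} := by
    refine ⟨0, ?_⟩
    rintro r ⟨u, -, a, -, rfl⟩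
    exact measureReal_nonneg
  obtain ⟨w, hw⟩ : ∃ w : 𝔼, ∀ x, ψ x = ⟪w, x⟫ :=
    ⟨(InnerProductSpace.toDual ℝ 𝔼).symm ψ, fun x => by
      rw [InnerProductSpace.toDual_symm_apply]⟩
  have hfin : volume (lowerCap K ψ p t) ≠ ⊤ := (volume_lowerCap_ne_top hK ψ p t)
  by_cases h0 : w = 0
  · -- the functional vanishes, so the cap is all of `K`, and any half-space through `z` will do
    let u : 𝔼 := EuclideanSpace.single ⟨0, hd⟩ 1
    have hu : ‖u‖ = 1 := by simp [u]
    refine (csInf_le hbdd ⟨u, hu, ⟪u, z⟫, le_rfl, rfl⟩).trans (measureReal_mono ?_ hfin)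
    rintro x ⟨hx, -⟩
    refine ⟨hx, ?_⟩
    simp only [hw, h0, inner_zero_left] at hz ⊢
    exact hz
  · have hn : 0 < ‖w‖ := norm_pos_iff.2 h0
    refine csInf_le hbdd ⟨-(‖w‖⁻¹ • w), ?_, -(‖w‖⁻¹ * (ψ p + t)), ?_, ?_⟩
    · rw [norm_neg, norm_smul, norm_inv, norm_norm, inv_mul_cancel₀ hn.ne']
    · rw [inner_neg_left, real_inner_smul_left, ← hw, neg_le_neg_iff]
      exact mul_le_mul_of_nonneg_left hz (by positivity)
    · congr 1
      ext x
      refine and_congr_right fun _ => ?_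
      simp only [mem_ofPred_eq]
      rw [inner_neg_left, real_inner_smul_left, ← hw, neg_le_neg_iff]
      exact (mul_le_mul_iff_of_pos_left (by positivity)).symm

theorem minCapVol_set_nonempty (hd : 1 ≤ d) (K : Set 𝔼) (z : 𝔼) :
    {r : ℝ | ∃ u : 𝔼, ‖u‖ = 1 ∧ ∃ a : ℝ, a ≤ ⟪u, z⟫ ∧
      r = volume.real (K ∩ {x | a ≤ ⟪u, x⟫})}.Nonempty :=
  ⟨_, EuclideanSpace.single ⟨0, hd⟩ 1, by simp, _, le_rfl, rfl⟩

/-- A cap through `z` of volume close to the infimum `minCapVol K z`. -/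
theorem exists_lowerCap_lt {K : Set 𝔼} (hd : 1 ≤ d) (hK : IsCompact K) {z : 𝔼} (hz : z ∈ K) {r : ℝ}
    (hr : minCapVol K z < r) :
    ∃ ψ : 𝔼 →L[ℝ] ℝ, ψ ≠ 0 ∧ ∃ p ∈ K, (∀ x ∈ K, ψ p ≤ ψ x) ∧
      volume.real (lowerCap K ψ p (ψ z - ψ p)) < r := by
  obtain ⟨_, ⟨u, hu, a, ha, rfl⟩, hlt⟩ := exists_lt_of_csInf_lt (minCapVol_set_nonempty hd K z) hr
  have hcont : Continuous fun x : 𝔼 => -⟪u, x⟫ := by fun_prop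
  obtain ⟨p, hp, hmin⟩ := hK.exists_isMinOn ⟨z, hz⟩ hcont.continuousOn
  refine ⟨-(innerSL ℝ u), ?_, p, hp, fun x hx => by simpa using hmin hx,
    (measureReal_mono ?_ ?_).trans_lt hlt⟩
  · intro h0
    have := congrArg (fun f : 𝔼 →L[ℝ] ℝ => f u) h0
    simp [hu] at this
  · rintro x ⟨hx, hx'⟩
    refine ⟨hx, ?_⟩
    simp at hx'
    exact ha.trans hx'
  · exact (hK.inter_right (isClosed_le continuous_const (by fun_prop))).measure_ne_top

/-- A half-space through `z` contains half of the Macbeath region at `z`, by symmetry. -/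
theorem volume_real_symCore_le {K : Set 𝔼} (hd : 1 ≤ d) (hK : IsCompact K) (z : 𝔼) :
    volume.real (symCore K z) ≤ 2 * minCapVol K z := by
  suffices h : volume.real (symCore K z) / 2 ≤ minCapVol K z by linarith
  refine le_csInf (minCapVol_set_nonempty hd K z) ?_
  rintro _ ⟨u, -, a, ha, rfl⟩
  set A := {w ∈ symCore K z | 0 ≤ ⟪u, w⟫} with hA
  have hfin : volume (K ∩ {x | a ≤ ⟪u, x⟫}) ≠ ⊤ :=
    (hK.inter_right (isClosed_le continuous_const (by fun_prop))).measure_ne_top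
  have h1 : volume.real A ≤ volume.real (K ∩ {x | a ≤ ⟪u, x⟫}) := by
    have := volume_real_image_homothety 1 z A
    rw [abs_one, one_pow, one_mul] at this
    rw [← this]
    refine measureReal_mono ?_ hfin
    rintro _ ⟨w, ⟨⟨hw, -⟩, hw'⟩, rfl⟩
    simp only [one_smul]
    refine ⟨hw, ?_⟩
    simp only [mem_ofPred_eq, inner_add_right]
    linarith
  have h2 : volume.real ((fun y : 𝔼 => (0 : 𝔼) + (-1 : ℝ) • y) '' A) = volume.real A := by
    rw [volume_real_image_homothety]; simp
  have h3 : symCore K z ⊆ A ∪ (fun y : 𝔼 => (0 : 𝔼) + (-1 : ℝ) • y) '' A := by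
    rintro w hw
    rcases le_total 0 ⟪u, w⟫ with h | h
    · exact Or.inl ⟨hw, h⟩
    · refine Or.inr ⟨-w, ⟨⟨?_, ?_⟩, ?_⟩, by simp⟩
      · simpa [← sub_eq_add_neg] using hw.2
      · simpa using hw.1
      · simpa using h
  have hN := (isCompact_symCore hK z).measure_lt_top (μ := volume)
  have hAfin : volume A < ⊤ := (measure_mono fun w hw => hw.1).trans_lt hN
  have hA'fin : volume ((fun y : 𝔼 => (0 : 𝔼) + (-1 : ℝ) • y) '' A) < ⊤ := by
    refine (measure_mono ?_).trans_lt hN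
    rintro _ ⟨w, ⟨⟨h, h'⟩, -⟩, rfl⟩
    exact ⟨by simpa [← sub_eq_add_neg] using h', by simpa using h⟩
  have h4 := (measureReal_mono h3 (measure_union_lt_top hAfin hA'fin).ne).trans
    (measureReal_union_le _ _)
  linarith

/-- Widening a cap by a factor `r ≥ 1` multiplies its volume by at most `r ^ d`. -/
theorem volume_real_lowerCap_mul_le {K : Set 𝔼} (hK : IsCompact K) (hc : Convex ℝ K)
    {ψ : 𝔼 →L[ℝ] ℝ} {p : 𝔼} (hp : p ∈ K) {r t : ℝ} (hr : 1 ≤ r) :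
    volume.real (lowerCap K ψ p (r * t)) ≤ r ^ d * volume.real (lowerCap K ψ p t) := by
  have hr0 : 0 < r := by linarith
  have hi1 : r⁻¹ ≤ 1 := inv_le_one_of_one_le₀ hr
  have h := volume_real_image_homothety r⁻¹ ((1 - r⁻¹) • p) (lowerCap K ψ p (r * t))
  have hsub : (fun y => (1 - r⁻¹) • p + r⁻¹ • y) '' lowerCap K ψ p (r * t) ⊆ lowerCap K ψ p t := by
    rintro _ ⟨y, ⟨hy, hy'⟩, rfl⟩
    refine ⟨hc hp hy (by linarith) (by positivity) (by ring), ?_⟩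
    simp only [map_add, map_smul, smul_eq_mul]
    have : r⁻¹ * ψ y ≤ r⁻¹ * (ψ p + r * t) := mul_le_mul_of_nonneg_left hy' (by positivity)
    have h2 : r⁻¹ * (ψ p + r * t) = r⁻¹ * ψ p + t := by field_simp
    linarith
  have h3 := measureReal_mono hsub (volume_lowerCap_ne_top hK ψ p t)
  rw [h, abs_of_pos (by positivity), inv_pow] at h3
  rwa [inv_mul_le_iff₀ (by positivity)] at h3

/-- The key step towards Macbeath's lemma: if `C` is a cap through `z` of nearly minimal volume,
then its reflection in `z`, shrunk by a constant factor, stays in `K`. Were some reflected point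
`z - κ⁻¹ • (x - z)` outside `K`, a functional separating it from `K` would grow quickly towards
`x`; tilting the cap by that functional gives a half-space through `z` whose part of `K` can be
sheared towards `x` inside the doubled cap with a large determinant, so it would be too small. -/
theorem sub_smul_mem_of_mem_lowerCap {K : Set 𝔼} (hd : 1 ≤ d) (hK : IsCompact K) (hc : Convex ℝ K)
    {z : 𝔼} (hzK : z ∈ interior K) (hv : 0 < minCapVol K z) {ψ : 𝔼 →L[ℝ] ℝ} {p : 𝔼} (hp : p ∈ K)
    (hmin : ∀ x ∈ K, ψ p ≤ ψ x)
    (hvol : volume.real (lowerCap K ψ p (ψ z - ψ p)) ≤ 2 * minCapVol K z)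
    (hpz : ψ p < ψ z) {x : 𝔼} (hx : x ∈ lowerCap K ψ p (ψ z - ψ p)) :
    z - ((4 : ℝ) ^ (d + 1))⁻¹ • (x - z) ∈ K := by
  set κ : ℝ := (4 : ℝ) ^ (d + 1) with hκ
  have hκ0 : 0 < κ := by positivity
  by_contra hy
  obtain ⟨f, a, hfa, hfK⟩ := geometric_hahn_banach_point_closed hc hK.isClosed hy
  have hz := interior_subset hzK
  have hfz := hfK z hz
  -- normalise both functionals to take the value `1` at `z`
  set t := ψ z - ψ p with ht
  have ht0 : 0 < t := by linarith
  set m : 𝔼 →L[ℝ] ℝ := (f z - a)⁻¹ • f with hm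
  have hb : 0 < f z - a := by linarith
  have hmK : ∀ g ∈ K, m z - 1 ≤ m g := by
    intro g hg
    have h1 : m z - 1 = (f z - a)⁻¹ * a := by
      simp only [hm, smul_apply, smul_eq_mul]; field_simp; ring
    rw [h1]
    exact mul_le_mul_of_nonneg_left (hfK g hg).le (by positivity)
  have hmx : κ < m (x - z) := by
    have h1 : m (z - κ⁻¹ • (x - z)) < m z - 1 := by
      have h1 : m z - 1 = (f z - a)⁻¹ * a := by
        simp only [hm, smul_apply, smul_eq_mul]; field_simp; ring
      rw [h1]
      exact mul_lt_mul_of_pos_left hfa (by positivity)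
    rw [map_sub, map_smul, smul_eq_mul] at h1
    have : 1 < κ⁻¹ * m (x - z) := by linarith
    rwa [lt_inv_mul_iff₀ hκ0, mul_one] at this
  set χ : 𝔼 →L[ℝ] ℝ := t⁻¹ • ψ + m with hχ
  -- the tilted half-space section
  set G := lowerCap K χ z 0 with hG
  have hGv : minCapVol K z ≤ volume.real G := minCapVol_le_lowerCap hd hK χ (by simp)
  have hGψ : ∀ g ∈ G, g ∈ K ∧ m g ≤ m z + 1 ∧ ψ g ≤ ψ p + 2 * t := by
    rintro g ⟨hg, hg'⟩
    have h1 := hmK g hg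
    have h2 := hmin g hg
    simp only [hχ, add_apply, smul_apply, smul_eq_mul,
      add_zero] at hg'
    have h3 : t⁻¹ * (ψ g - ψ z) ≤ m z - m g := by linarith
    rw [inv_mul_le_iff₀ ht0] at h3
    refine ⟨hg, ?_, ?_⟩
    · have h4 : -t ≤ ψ g - ψ z := by linarith
      have h5 : -t ≤ t * (m z - m g) := h4.trans h3
      nlinarith
    · have h5 : t * (m z - m g) ≤ t * 1 := mul_le_mul_of_nonneg_left (by linarith) ht0.le
      linarith
  have hsh := volume_real_image_shear (1 / 2) ((1 / 2 : ℝ) • m) (x - z)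
    ((1 / 2 : ℝ) • z + (1 / 2 * (1 / 2 * (1 - m z))) • (x - z)) G
  have hsub : (fun y => ((1 / 2 : ℝ) • z + (1 / 2 * (1 / 2 * (1 - m z))) • (x - z)) +
      (1 / 2 : ℝ) • (y + ((1 / 2 : ℝ) • m) y • (x - z))) '' G ⊆ lowerCap K ψ p (2 * t) := by
    rintro _ ⟨g, hg, rfl⟩
    obtain ⟨hgK, hg1, hg2⟩ := hGψ g hg
    have hg3 := hmK g hgK
    set q := (1 + m g - m z) / 2 with hq
    have hq0 : 0 ≤ q := by rw [hq]; linarith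
    have hq1 : q ≤ 1 := by rw [hq]; linarith
    have e : ((1 / 2 : ℝ) • z + (1 / 2 * (1 / 2 * (1 - m z))) • (x - z)) +
      (1 / 2 : ℝ) • (g + ((1 / 2 : ℝ) • m) g • (x - z)) =
        (1 / 2 : ℝ) • g + (1 / 2 : ℝ) • ((1 - q) • z + q • x) := by
      simp only [smul_apply, smul_eq_mul, hq]
      module
    simp only [e]
    have hzx : (1 - q) • z + q • x ∈ K := hc hz hx.1 (by linarith) hq0 (by ring)
    refine ⟨hc hgK hzx (by norm_num) (by norm_num) (by norm_num), ?_⟩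
    simp only [map_add, map_smul, smul_eq_mul]
    have hx2 := hx.2
    nlinarith
  have h1 := measureReal_mono hsub (volume_lowerCap_ne_top hK ψ p (2 * t))
  rw [hsh] at h1
  have h2 := volume_real_lowerCap_mul_le hK hc (ψ := ψ) (t := t) hp (show (1 : ℝ) ≤ 2 by norm_num)
  simp only [smul_apply, smul_eq_mul] at h1
  have h3 : κ / 2 + 1 ≤ |1 + 1 / 2 * m (x - z)| := by
    refine le_trans ?_ (le_abs_self _)
    linarith
  rw [abs_of_pos (by norm_num : (0 : ℝ) < 1 / 2)] at h1
  have h4 : (1 / 2 : ℝ) ^ d * (κ / 2 + 1) * minCapVol K z ≤ 2 ^ d * (2 * minCapVol K z) := by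
    calc (1 / 2 : ℝ) ^ d * (κ / 2 + 1) * minCapVol K z
        ≤ (1 / 2) ^ d * |1 + 1 / 2 * m (x - z)| * volume.real G := by gcongr
      _ ≤ volume.real (lowerCap K ψ p (2 * t)) := h1
      _ ≤ 2 ^ d * volume.real (lowerCap K ψ p t) := h2
      _ ≤ _ := by gcongr
  have h5 : (1 / 2 : ℝ) ^ d * (κ / 2) = 2 * 2 ^ d := by
    rw [hκ, pow_succ, show (4 : ℝ) = 2 * 2 by norm_num, mul_pow]
    rw [one_div, inv_pow]; field_simp
  rw [mul_add, h5] at h4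
  have h6 : 0 < (1 / 2 : ℝ) ^ d * minCapVol K z := by positivity
  nlinarith

/-! ### Macbeath's lemma and the level sets of `minCapVol` -/

theorem mem_interior_of_minCapVol_pos {K : Set 𝔼} (hd : 1 ≤ d) (hK : IsCompact K)
    (hc : Convex ℝ K) {z : 𝔼} (hv : 0 < minCapVol K z) : z ∈ interior K := by
  by_contra hz
  obtain ⟨f, hf⟩ := geometric_hahn_banach_open_point hc.interior isOpen_interior hz
  have h1 : lowerCap K (-f) z 0 ⊆ frontier K := by
    rintro x ⟨hx, hx'⟩
    rw [hK.isClosed.frontier_eq]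
    refine ⟨hx, fun hi => ?_⟩
    have := hf x hi
    simp at hx'
    linarith
  have h2 : volume.real (lowerCap K (-f) z 0) = 0 := by
    rw [Measure.real, measure_mono_null h1 (hc.addHaar_frontier volume), ENNReal.toReal_zero]
  have h3 := minCapVol_le_lowerCap hd hK (-f) (z := z) (p := z) (t := 0) (by simp)
  linarith

theorem lt_apply_of_mem_interior {K : Set 𝔼} {ψ : 𝔼 →L[ℝ] ℝ} (hψ : ψ ≠ 0) {p z : 𝔼}
    (hmin : ∀ x ∈ K, ψ p ≤ ψ x) (hz : z ∈ interior K) : ψ p < ψ z := by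
  by_contra hcon
  have hloc : IsLocalMin ψ z := by
    filter_upwards [mem_interior_iff_mem_nhds.1 hz] with x hx
    exact (not_lt.1 hcon).trans (hmin x hx)
  exact hψ (hloc.hasFDerivAt_eq_zero ψ.hasFDerivAt)

/-- A cap with `z` on its bounding hyperplane, of positive width and of volume at most twice the
infimum `minCapVol K z`; the infimum need not be shown to be attained. -/
theorem exists_nearMinimal_cap {K : Set 𝔼} (hd : 1 ≤ d) (hK : IsCompact K) (hc : Convex ℝ K)
    {z : 𝔼} (hv : 0 < minCapVol K z) :
    ∃ ψ : 𝔼 →L[ℝ] ℝ, ∃ p ∈ K, (∀ x ∈ K, ψ p ≤ ψ x) ∧ ψ p < ψ z ∧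
      volume.real (lowerCap K ψ p (ψ z - ψ p)) ≤ 2 * minCapVol K z := by
  have hz := mem_interior_of_minCapVol_pos hd hK hc hv
  obtain ⟨ψ, hψ, p, hp, hmin, hlt⟩ := exists_lowerCap_lt hd hK (interior_subset hz)
    (show minCapVol K z < 2 * minCapVol K z by linarith)
  exact ⟨ψ, p, hp, hmin, lt_apply_of_mem_interior hψ hmin hz, hlt.le⟩

/-- The constant of Macbeath's lemma in dimension `d`. -/
noncomputable def macbeathConst (d : ℕ) : ℝ := (((4 : ℝ) ^ (d + 1))⁻¹) ^ d

theorem macbeathConst_pos (d : ℕ) : 0 < macbeathConst d := by unfold macbeathConst; positivity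

/-- **Macbeath's lemma**: the Macbeath region at `z` has volume at least a constant times the
minimal cap volume at `z`. -/
theorem macbeathConst_mul_minCapVol_le {K : Set 𝔼} (hd : 1 ≤ d) (hK : IsCompact K)
    (hc : Convex ℝ K) {z : 𝔼} (hv : 0 < minCapVol K z) :
    macbeathConst d * minCapVol K z ≤ volume.real (symCore K z) := by
  have hz := mem_interior_of_minCapVol_pos hd hK hc hv
  obtain ⟨ψ, p, hp, hmin, hpz, hvol⟩ := exists_nearMinimal_cap hd hK hc hv
  set q : ℝ := ((4 : ℝ) ^ (d + 1))⁻¹ with hq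
  have hq0 : 0 < q := by positivity
  have hq1 : q ≤ 1 := inv_le_one_of_one_le₀ (one_le_pow₀ (by norm_num))
  have hsub : (fun x => (-q) • z + q • x) '' lowerCap K ψ p (ψ z - ψ p) ⊆ symCore K z := by
    rintro _ ⟨x, hx, rfl⟩
    refine ⟨?_, ?_⟩
    · have := hc (interior_subset hz) hx.1 (show 0 ≤ 1 - q by linarith) hq0.le (by ring)
      convert this using 1
      module
    · have := sub_smul_mem_of_mem_lowerCap hd hK hc hz hv hp hmin hvol hpz hx
      convert this using 1
      rw [← hq]
      module
  have h1 := measureReal_mono hsub ((isCompact_symCore hK z).measure_lt_top (μ := volume)).ne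
  rw [volume_real_image_homothety, abs_of_pos hq0] at h1
  refine le_trans ?_ h1
  exact mul_le_mul_of_nonneg_left (minCapVol_le_lowerCap hd hK ψ (by linarith))
    (macbeathConst_pos d).le

theorem isClosed_floatingBody {K : Set 𝔼} (hd : 1 ≤ d) (hK : IsCompact K) (s : ℝ) :
    IsClosed (floatingBody K s) := by
  rw [← isOpen_compl_iff, isOpen_iff_mem_nhds]
  intro z hz
  by_cases hzK : z ∈ K
  swap
  · filter_upwards [hK.isClosed.isOpen_compl.mem_nhds hzK] with x hx hx'
    exact hx hx'.1
  have hv : minCapVol K z < s := by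
    by_contra h
    exact hz ⟨hzK, not_lt.1 h⟩
  obtain ⟨ψ, -, p, hp, hmin, hlt⟩ := exists_lowerCap_lt hd hK hzK hv
  -- slightly wider parallel caps still have volume below `s`
  have htend := tendsto_measure_biInter_gt (μ := volume) (a := ψ z - ψ p)
    (s := fun t => lowerCap K ψ p t)
    (fun r _ => (isCompact_lowerCap hK ψ p r).measurableSet.nullMeasurableSet)
    (fun i j _ hij x hx => ⟨hx.1, hx.2.trans (by linarith)⟩)
    ⟨ψ z - ψ p + 1, by linarith, volume_lowerCap_ne_top hK ψ p _⟩
  have hint : (⋂ r > ψ z - ψ p, lowerCap K ψ p r) = lowerCap K ψ p (ψ z - ψ p) := by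
    ext x
    simp only [mem_iInter]
    constructor
    · intro h
      refine ⟨(h (ψ z - ψ p + 1) (by simp)).1, ?_⟩
      refine le_of_forall_pos_le_add fun ε hε => ?_
      have := (h (ψ z - ψ p + ε) (by simp [hε])).2
      linarith
    · intro h r hr
      exact ⟨h.1, h.2.trans (by simp at hr ⊢; linarith)⟩
  rw [hint] at htend
  have hlt' : volume (lowerCap K ψ p (ψ z - ψ p)) < ENNReal.ofReal s := by
    rw [← ENNReal.ofReal_toReal (volume_lowerCap_ne_top hK ψ p (ψ z - ψ p))]
    exact (ENNReal.ofReal_lt_ofReal_iff (measureReal_nonneg.trans_lt hlt)).2 hlt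
  obtain ⟨r, hr1, hr2⟩ :=
    ((htend.eventually_lt_const hlt').and self_mem_nhdsWithin).exists
  have hopen : ∀ᶠ x in nhds z, ψ x < ψ p + r := by
    refine (ψ.continuous.tendsto z).eventually_lt_const ?_
    have hr3 : ψ z - ψ p < r := hr2
    linarith
  filter_upwards [hopen] with x hx hx'
  have h1 := minCapVol_le_lowerCap hd hK ψ (p := p) hx.le
  have h2 : volume.real (lowerCap K ψ p r) < s :=
    (ENNReal.lt_ofReal_iff_toReal_lt (volume_lowerCap_ne_top hK ψ p r)).1 hr1
  linarith [hx'.2]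

theorem mem_floatingBody_of_mem_levelSet {K : Set 𝔼} (hd : 1 ≤ d) (hK : IsCompact K) {s : ℝ}
    {z : 𝔼} (hz : z ∈ levelSet K s) : z ∈ floatingBody K s :=
  (isClosed_floatingBody hd hK s).frontier_subset hz

theorem half_smul_mem_symCore {K : Set 𝔼} (hc : Convex ℝ K) {z w y : 𝔼}
    (hw : w ∈ symCore K z) (hy : y ∈ symCore K z) :
    (1 / 2 : ℝ) • y ∈ symCore K (z + (1 / 2 : ℝ) • w) := by
  have h1 := hc hw.1 hy.1 (show (0 : ℝ) ≤ 1 / 2 by norm_num) (show (0 : ℝ) ≤ 1 / 2 by norm_num)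
    (by norm_num)
  have h2 := hc hw.1 hy.2 (show (0 : ℝ) ≤ 1 / 2 by norm_num) (show (0 : ℝ) ≤ 1 / 2 by norm_num)
    (by norm_num)
  constructor
  · convert h1 using 1; module
  · convert h2 using 1; module

/-- Were `minCapVol` much larger than `s` at a point of the level set, it would be at least `s` at
all nearby points, since their Macbeath regions contain half-size copies of that of `z`; the point
would then be interior to the floating body. -/
theorem minCapVol_le_of_mem_levelSet {K : Set 𝔼} (hd : 1 ≤ d) (hK : IsCompact K)
    (hc : Convex ℝ K) {s : ℝ} (hs : 0 < s) {z : 𝔼} (hz : z ∈ levelSet K s) :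
    minCapVol K z ≤ 2 * 2 ^ d / macbeathConst d * s := by
  have hzf := mem_floatingBody_of_mem_levelSet hd hK hz
  have hv : 0 < minCapVol K z := hs.trans_le hzf.2
  have hzi := mem_interior_of_minCapVol_pos hd hK hc hv
  by_contra hcon
  rw [not_le, div_mul_eq_mul_div, div_lt_iff₀ (macbeathConst_pos d)] at hcon
  refine hz.2 ?_
  rw [mem_interior_iff_mem_nhds]
  have h1 : ∀ᶠ x in nhds z, z + (2 : ℝ) • (x - z) ∈ K := by
    have : Filter.Tendsto (fun x : 𝔼 => z + (2 : ℝ) • (x - z)) (nhds z) (nhds z) := by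
      have hcont : Continuous fun x : 𝔼 => z + (2 : ℝ) • (x - z) := by fun_prop
      simpa using hcont.tendsto z
    exact this (mem_interior_iff_mem_nhds.1 hzi)
  have h2 : ∀ᶠ x in nhds z, z - (2 : ℝ) • (x - z) ∈ K := by
    have : Filter.Tendsto (fun x : 𝔼 => z - (2 : ℝ) • (x - z)) (nhds z) (nhds z) := by
      have hcont : Continuous fun x : 𝔼 => z - (2 : ℝ) • (x - z) := by fun_prop
      simpa using hcont.tendsto z
    exact this (mem_interior_iff_mem_nhds.1 hzi)
  filter_upwards [h1, h2] with x hx1 hx2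
  have hw : (2 : ℝ) • (x - z) ∈ symCore K z := ⟨hx1, hx2⟩
  have hx : z + (1 / 2 : ℝ) • ((2 : ℝ) • (x - z)) = x := by module
  have hsub : (fun y : 𝔼 => (0 : 𝔼) + (1 / 2 : ℝ) • y) '' symCore K z ⊆ symCore K x := by
    rintro _ ⟨y, hy, rfl⟩
    have := half_smul_mem_symCore hc hw hy
    rw [hx] at this
    simpa using this
  have h3 := measureReal_mono hsub ((isCompact_symCore hK x).measure_lt_top (μ := volume)).ne
  rw [volume_real_image_homothety, abs_of_pos (by norm_num : (0 : ℝ) < 1 / 2)] at h3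
  have h4 := volume_real_symCore_le hd hK x
  have h5 := macbeathConst_mul_minCapVol_le hd hK hc hv
  have h6 : x ∈ K := by
    have := mem_of_mem_symCore hc (hsub ⟨0, by simpa [symCore] using hzf.1, rfl⟩)
    exact this
  refine ⟨h6, ?_⟩
  rw [one_div, inv_pow, inv_mul_le_iff₀ (by positivity)] at h3
  have h7 : 2 * 2 ^ d * s < 2 ^ d * (2 * minCapVol K x) := by
    calc 2 * 2 ^ d * s < minCapVol K z * macbeathConst d := hcon
      _ ≤ volume.real (symCore K z) := by rw [mul_comm]; exact h5
      _ ≤ 2 ^ d * volume.real (symCore K x) := h3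
      _ ≤ _ := by gcongr
  have h8 : (2 * 2 ^ d : ℝ) * s < 2 * 2 ^ d * minCapVol K x := by linarith
  exact (lt_of_mul_lt_mul_left h8 (by positivity)).le

/-- Points of the Macbeath region `M(z, 1/2)` have minimal cap volume at most a constant times that
of `z`, hence small Macbeath regions. -/
theorem volume_real_symCore_le_of_mem_macbeath {K : Set 𝔼} (hd : 1 ≤ d) (hK : IsCompact K)
    (hc : Convex ℝ K) {z x : 𝔼} (hv : 0 < minCapVol K z) (hx : x ∈ macbeath K z (1 / 2)) :
    volume.real (symCore K x) ≤ 4 * 2 ^ d * minCapVol K z := by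
  obtain ⟨ψ, p, hp, hmin, hpz, hvol⟩ := exists_nearMinimal_cap hd hK hc hv
  have h1 : ψ x ≤ ψ p + 2 * (ψ z - ψ p) := by
    obtain ⟨w, ⟨hw1, hw2⟩, rfl⟩ := hx
    have h2 := hmin _ hw2
    simp only [map_sub, map_add, map_smul, smul_eq_mul] at h2 ⊢
    linarith
  have h2 := minCapVol_le_lowerCap hd hK ψ h1
  have h3 := volume_real_lowerCap_mul_le hK hc (ψ := ψ) (t := ψ z - ψ p) hp
    (show (1 : ℝ) ≤ 2 by norm_num)
  have h4 := volume_real_symCore_le hd hK x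
  have h5 : (2 : ℝ) ^ d * volume.real (lowerCap K ψ p (ψ z - ψ p)) ≤
      2 ^ d * (2 * minCapVol K z) := by gcongr
  linarith

/-! ### The volume below a hyperbola in the unit cube -/

/-- The points of the unit cube whose coordinates have product at most `τ`. -/
def hyperbolicRegion (n : ℕ) (τ : ℝ) : Set (Fin n → ℝ) :=
  {ν | (∀ i, 0 ≤ ν i ∧ ν i ≤ 1) ∧ ∏ i, ν i ≤ τ}

theorem isClosed_hyperbolicRegion (n : ℕ) (τ : ℝ) : IsClosed (hyperbolicRegion n τ) := by
  have h1 : IsClosed {ν : Fin n → ℝ | ∀ i, 0 ≤ ν i ∧ ν i ≤ 1} := by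
    simp only [ofPred_forall]
    exact isClosed_iInter fun i => (isClosed_le continuous_const (continuous_apply i)).inter
      (isClosed_le (continuous_apply i) continuous_const)
  exact h1.inter (isClosed_le (by fun_prop : Continuous fun ν : Fin n → ℝ => ∏ i, ν i)
    continuous_const)

theorem volume_hyperbolicRegion_le_one (n : ℕ) (τ : ℝ) : volume (hyperbolicRegion n τ) ≤ 1 := by
  have h : hyperbolicRegion n τ ⊆ Icc (0 : Fin n → ℝ) 1 :=
    fun ν hν => ⟨fun i => (hν.1 i).1, fun i => (hν.1 i).2⟩
  refine (measure_mono h).trans ?_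
  rw [Real.volume_Icc_pi]
  simp

theorem integral_indicator_rpow {θ : ℝ} (hθ : θ < 1) :
    Integrable ((Ioc (0 : ℝ) 1).indicator fun x => x ^ (-θ)) ∧
      ∫ x, (Ioc (0 : ℝ) 1).indicator (fun x => x ^ (-θ)) x = (1 - θ)⁻¹ := by
  have h1 : IntervalIntegrable (fun x : ℝ => x ^ (-θ)) volume 0 1 :=
    intervalIntegral.intervalIntegrable_rpow' (by linarith)
  rw [intervalIntegrable_iff_integrableOn_Ioc_of_le zero_le_one] at h1
  refine ⟨h1.integrable_indicator measurableSet_Ioc, ?_⟩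
  rw [integral_indicator measurableSet_Ioc, ← intervalIntegral.integral_of_le zero_le_one,
    integral_rpow (Or.inl (by linarith))]
  rw [Real.one_rpow, Real.zero_rpow (by linarith), sub_zero, one_div]
  congr 1
  ring

/-- Slicing in the first coordinate and bounding `min 1 (τ / ∏ y)` by `(τ / ∏ y) ^ θ`. -/
theorem volume_hyperbolicRegion_le_rpow (k : ℕ) {τ θ : ℝ} (hτ : 0 < τ) (hθ0 : 0 ≤ θ)
    (hθ : θ < 1) :
    volume (hyperbolicRegion (k + 1) τ) ≤ ENNReal.ofReal (τ ^ θ * ((1 - θ)⁻¹) ^ k) := by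
  set g : ℝ → ℝ := (Ioc (0 : ℝ) 1).indicator fun x => x ^ (-θ) with hg
  have hg0 : ∀ x, 0 ≤ g x := fun x =>
    indicator_nonneg (fun y hy => Real.rpow_nonneg hy.1.le _) x
  obtain ⟨hgi, hgI⟩ := integral_indicator_rpow hθ
  have hm := (isClosed_hyperbolicRegion (k + 1) τ).measurableSet
  have hmp := (volume_preserving_piFinSuccAbove (fun _ : Fin (k + 1) => ℝ) 0).symm
  rw [← hmp.measure_preimage hm.nullMeasurableSet, Measure.volume_eq_prod,
    Measure.prod_apply_symm (hmp.measurable hm)]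
  have hInt : Integrable (fun y : Fin k → ℝ => τ ^ θ * ∏ i, g (y i)) :=
    (Integrable.fintype_prod fun _ => hgi).const_mul _
  have hval : ∫ y : Fin k → ℝ, τ ^ θ * ∏ i, g (y i) = τ ^ θ * ((1 - θ)⁻¹) ^ k := by
    rw [integral_const_mul, integral_fintype_prod_volume_eq_pow g, hgI, Fintype.card_fin]
  rw [← hval, ofReal_integral_eq_lintegral_ofReal hInt
    (Filter.Eventually.of_forall fun y =>
      mul_nonneg (by positivity) (Finset.prod_nonneg fun i _ => hg0 _))]
  have hae : ∀ᵐ y : Fin k → ℝ, ∀ i, y i ≠ 0 := by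
    rw [ae_all_iff]
    exact fun i => Measure.ae_eval_ne (μ := fun _ => volume) i 0
  refine lintegral_mono_ae ?_
  filter_upwards [hae] with y hy
  have hmem : ∀ x, (x, y) ∈ (MeasurableEquiv.piFinSuccAbove (fun _ : Fin (k + 1) => ℝ) 0).symm ⁻¹'
      hyperbolicRegion (k + 1) τ ↔
      ((0 ≤ x ∧ x ≤ 1) ∧ ∀ i, 0 ≤ y i ∧ y i ≤ 1) ∧ x * ∏ i, y i ≤ τ := by
    intro x
    simp [hyperbolicRegion, Fin.forall_fin_succ, Fin.prod_univ_succ, Fin.insertNthEquiv]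
  by_cases hy1 : ∀ i, 0 ≤ y i ∧ y i ≤ 1
  · have hpos : ∀ i, 0 < y i := fun i => lt_of_le_of_ne (hy1 i).1 (hy i).symm
    have hP : 0 < ∏ i, y i := Finset.prod_pos fun i _ => hpos i
    have hgy : ∏ i, g (y i) = (∏ i, y i) ^ (-θ) := by
      rw [← Real.finsetProd_rpow _ _ fun i _ => (hpos i).le]
      exact Finset.prod_congr rfl fun i _ =>
        indicator_of_mem (show y i ∈ Ioc (0 : ℝ) 1 from ⟨hpos i, (hy1 i).2⟩) _
    have hsub : (fun x => (x, y)) ⁻¹' ((MeasurableEquiv.piFinSuccAbove (fun _ : Fin (k + 1) => ℝ)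
        0).symm ⁻¹' hyperbolicRegion (k + 1) τ) ⊆ Icc 0 (min 1 (τ / ∏ i, y i)) := by
      intro x hx
      obtain ⟨⟨⟨h1, h2⟩, -⟩, h3⟩ := (hmem x).1 hx
      exact ⟨h1, le_min h2 ((le_div_iff₀ hP).2 h3)⟩
    refine (measure_mono hsub).trans ?_
    rw [Real.volume_Icc, sub_zero]
    refine ENNReal.ofReal_le_ofReal ?_
    rw [hgy, Real.rpow_neg hP.le, ← div_eq_mul_inv, ← Real.div_rpow hτ.le hP.le]
    rcases le_total 1 (τ / ∏ i, y i) with h | h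
    · rw [min_eq_left h]
      exact Real.one_le_rpow h hθ0
    · rw [min_eq_right h]
      exact Real.self_le_rpow_of_le_one (by positivity) h hθ.le
  · have hemp : (fun x => (x, y)) ⁻¹' ((MeasurableEquiv.piFinSuccAbove (fun _ : Fin (k + 1) => ℝ)
        0).symm ⁻¹' hyperbolicRegion (k + 1) τ) = ∅ := by
      ext x
      simp only [mem_empty_iff_false, iff_false]
      exact fun hx => hy1 ((hmem x).1 hx).1.2
    rw [hemp, measure_empty]
    exact zero_le

/-- Choosing the exponent `θ = 1 - (1 + log (1/τ))⁻¹` gives the sharp power of the logarithm. -/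
theorem volume_real_hyperbolicRegion_le (k : ℕ) {τ : ℝ} (hτ : 0 < τ) (hτ1 : τ ≤ 1) :
    volume.real (hyperbolicRegion (k + 1) τ) ≤
      Real.exp 1 * τ * (1 + Real.log τ⁻¹) ^ k := by
  have hL : 0 ≤ Real.log τ⁻¹ := Real.log_nonneg ((one_le_inv₀ hτ).2 hτ1)
  set L := Real.log τ⁻¹ with hLdef
  have hLi : (1 + L)⁻¹ ≤ 1 := inv_le_one_of_one_le₀ (by linarith)
  have hLp : 0 < (1 + L)⁻¹ := by positivity
  have h := volume_hyperbolicRegion_le_rpow k hτ (θ := 1 - (1 + L)⁻¹) (by linarith) (by linarith)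
  rw [sub_sub_cancel, inv_inv] at h
  have h1 : τ ^ (1 - (1 + L)⁻¹) ≤ Real.exp 1 * τ := by
    have e1 : Real.log τ = -L := by rw [hLdef, Real.log_inv, neg_neg]
    have e2 : τ = Real.exp (-L) := by rw [← e1, Real.exp_log hτ]
    rw [Real.rpow_def_of_pos hτ, e1, e2, ← Real.exp_add, Real.exp_le_exp]
    have : L * (1 + L)⁻¹ ≤ 1 := by
      rw [mul_inv_le_iff₀ (by linarith)]; linarith
    nlinarith
  refine ENNReal.toReal_le_of_le_ofReal (by positivity) (h.trans (ENNReal.ofReal_le_ofReal ?_))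
  gcongr

/-- The form used below: the volume is controlled after scaling by `D`, with no case distinction on
the size of `τ = σ / D`. -/
theorem mul_volume_real_hyperbolicRegion_le (k : ℕ) {D D' σ : ℝ} (hD : 0 < D) (hDD : D ≤ D')
    (hσ : 0 < σ) (hσD : σ ≤ D') :
    D * volume.real (hyperbolicRegion (k + 1) (σ / D)) ≤
      Real.exp 1 * σ * (1 + Real.log (D' / σ)) ^ k := by
  have hlog : 0 ≤ Real.log (D' / σ) := Real.log_nonneg ((one_le_div hσ).2 hσD)
  rcases le_total D σ with h | h
  · have h1 : volume.real (hyperbolicRegion (k + 1) (σ / D)) ≤ 1 :=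
      ENNReal.toReal_le_of_le_ofReal zero_le_one (by
        simpa using volume_hyperbolicRegion_le_one (k + 1) (σ / D))
    have he : (1 : ℝ) ≤ Real.exp 1 := Real.one_le_exp zero_le_one
    calc D * volume.real (hyperbolicRegion (k + 1) (σ / D)) ≤ σ * 1 := by gcongr
      _ ≤ (Real.exp 1 * σ) * 1 := by nlinarith
      _ ≤ _ := by
        gcongr
        exact one_le_pow₀ (by linarith)
  · have h1 := volume_real_hyperbolicRegion_le k (div_pos hσ hD) ((div_le_one hD).2 h)
    rw [inv_div] at h1
    have hlog' : 0 ≤ Real.log (D / σ) := Real.log_nonneg ((one_le_div hσ).2 h)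
    calc D * volume.real (hyperbolicRegion (k + 1) (σ / D))
        ≤ D * (Real.exp 1 * (σ / D) * (1 + Real.log (D / σ)) ^ k) := by gcongr
      _ = Real.exp 1 * σ * (1 + Real.log (D / σ)) ^ k := by field_simp
      _ ≤ _ := by gcongr

/-! ### Volume estimates in a single corner simplex -/

/-- The volume of the parallelepiped spanned by the vectors `g i`. -/
noncomputable def spanVol (g : Fin d → 𝔼) : ℝ :=
  |LinearMap.det ((Fintype.linearCombination ℝ g) ∘ₗ
    (WithLp.linearEquiv 2 ℝ (Fin d → ℝ)).toLinearMap : 𝔼 →ₗ[ℝ] 𝔼)|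

theorem spanVol_nonneg (g : Fin d → 𝔼) : 0 ≤ spanVol g := abs_nonneg _

theorem volume_real_image_sum_smul (x : 𝔼) (g : Fin d → 𝔼) (R : Set (Fin d → ℝ)) :
    volume.real ((fun ν : Fin d → ℝ => x + ∑ i, ν i • g i) '' R) =
      spanVol g * volume.real R := by
  have h1 : (fun ν : Fin d → ℝ => x + ∑ i, ν i • g i) '' R =
      (fun y => x + ((Fintype.linearCombination ℝ g) ∘ₗ
        (WithLp.linearEquiv 2 ℝ (Fin d → ℝ)).toLinearMap : 𝔼 →ₗ[ℝ] 𝔼) y) ''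
        ((WithLp.ofLp : 𝔼 → (Fin d → ℝ)) ⁻¹' R) := by
    ext y
    constructor
    · rintro ⟨ν, hν, rfl⟩
      exact ⟨WithLp.toLp 2 ν, hν, by simp [Fintype.linearCombination_apply]⟩
    · rintro ⟨w, hw, rfl⟩
      exact ⟨WithLp.ofLp w, hw, by simp [Fintype.linearCombination_apply]⟩
  rw [h1, volume_real_image_affine, spanVol]
  congr 1
  have :=
    (EuclideanSpace.volume_preserving_symm_measurableEquiv_toLp (Fin d)).measure_preimage_equiv R
  exact congrArg ENNReal.toReal this

/-- The simplex with vertices `b₀` and the points `b i`. -/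
def cornerSimplex (b₀ : 𝔼) (b : Fin d → 𝔼) : Set 𝔼 :=
  {x | ∃ l : Fin d → ℝ, (∀ i, 0 ≤ l i) ∧ ∑ i, l i ≤ 1 ∧ x = b₀ + ∑ i, l i • (b i - b₀)}

theorem add_sum_smul_sub_mem {K : Set 𝔼} (hc : Convex ℝ K) {b₀ : 𝔼} (h0 : b₀ ∈ K) {y : Fin d → 𝔼}
    (hy : ∀ i, y i ∈ K) {l : Fin d → ℝ} (hl : ∀ i, 0 ≤ l i) (hl1 : ∑ i, l i ≤ 1) :
    b₀ + ∑ i, l i • (y i - b₀) ∈ K := by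
  have := hc.sum_mem (t := Finset.univ) (w := Fin.cons (1 - ∑ i, l i) l)
    (z := (Fin.cons b₀ y : Fin (d + 1) → 𝔼)) ?_ ?_ ?_
  · rw [Fin.sum_univ_succ] at this
    simp only [Fin.cons_zero, Fin.cons_succ] at this
    convert this using 1
    simp only [smul_sub, Finset.sum_sub_distrib, ← Finset.sum_smul]
    module
  · intro i _
    refine Fin.cases ?_ (fun i => ?_) i
    · simpa using hl1
    · simpa using hl i
  · simp [Fin.sum_univ_succ]
  · intro i _
    refine Fin.cases ?_ (fun i => ?_) i
    · simpa using h0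
    · simpa using hy i

theorem apply_add_sum_smul_sub (ψ : 𝔼 →L[ℝ] ℝ) (b₀ : 𝔼) (b : Fin d → 𝔼) (l : Fin d → ℝ) (c : ℝ) :
    ψ (b₀ + ∑ i, l i • (b i - b₀)) - c =
      (1 - ∑ i, l i) * (ψ b₀ - c) + ∑ i, l i * (ψ (b i) - c) := by
  simp only [map_add, map_sum, map_smul, map_sub, smul_eq_mul, mul_sub, Finset.sum_sub_distrib,
    ← Finset.sum_mul]
  ring

/-- A system of points `b₀, b i` of `K` such that `K` reaches beyond each `b i`, as seen from
`b₀`, by a fixed proportion of the distance. -/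
structure IsCentralSystem (K : Set 𝔼) (b₀ : 𝔼) (b : Fin d → 𝔼) : Prop where
  base_mem : b₀ ∈ K
  mem : ∀ i, b i ∈ K
  beyond : ∀ i, b i + (d : ℝ)⁻¹ • (b i - b₀) ∈ K

theorem IsCentralSystem.add_smul_mem {K : Set 𝔼} {b₀ : 𝔼} {b : Fin d → 𝔼}
    (hb : IsCentralSystem K b₀ b) (hd : 1 ≤ d) (hc : Convex ℝ K)
    (i : Fin d) {r : ℝ} (hr : |r| ≤ (d : ℝ)⁻¹) : b i + r • (b i - b₀) ∈ K := by
  have hd' : (1 : ℝ) ≤ d := by exact_mod_cast hd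
  have hq : (d : ℝ)⁻¹ ≤ 1 := inv_le_one_of_one_le₀ hd'
  have hq0 : 0 < (d : ℝ)⁻¹ := by positivity
  set q := (d : ℝ)⁻¹ with hqd
  rw [abs_le] at hr
  have hmem := hc hb.base_mem (hb.beyond i) (show 0 ≤ (q - r) / (1 + q) by
      apply div_nonneg <;> linarith) (show 0 ≤ (1 + r) / (1 + q) by
      apply div_nonneg <;> linarith) (by field_simp; ring)
  convert hmem using 1
  have h1 : (q - r) / (1 + q) = 1 - (1 + r) / (1 + q) := by field_simp; ring
  have h2 : (1 + r) / (1 + q) * q = (1 + r) - (1 + r) / (1 + q) := by field_simp; ring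
  rw [h1, smul_add, smul_smul, h2]
  module

/-- The Macbeath region at a point with coordinates `ν` contains a parallelepiped with edges
proportional to `ν i • g i`, where `g i = a i • (b i - b₀)`. -/
theorem IsCentralSystem.spanVol_mul_le {K : Set 𝔼} {b₀ : 𝔼} {b : Fin d → 𝔼}
    (hb : IsCentralSystem K b₀ b) (hd : 1 ≤ d) (hK : IsCompact K)
    (hc : Convex ℝ K) {a ν : Fin d → ℝ} (ha : ∀ i, 0 ≤ a i) (hν : ∀ i, 0 ≤ ν i)
    (hsum : ∑ i, ν i * a i ≤ 1) :
    spanVol (fun i => a i • (b i - b₀)) * ((2 / d) ^ d * ∏ i, ν i) ≤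
      volume.real (symCore K (b₀ + ∑ i, ν i • a i • (b i - b₀))) := by
  have hd' : (1 : ℝ) ≤ d := by exact_mod_cast hd
  set x := b₀ + ∑ i, ν i • a i • (b i - b₀) with hx
  have key : ∀ w : Fin d → ℝ, (∀ i, |w i| ≤ ν i / d) → x + ∑ i, w i • a i • (b i - b₀) ∈ K := by
    intro w hw
    have hy : ∀ i, b i + (w i / ν i) • (b i - b₀) ∈ K := by
      intro i
      refine hb.add_smul_mem hd hc i ?_
      rcases eq_or_ne (ν i) 0 with h0 | h0
      · simp [h0]
      · have : 0 < ν i := lt_of_le_of_ne (hν i) h0.symm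
        rw [abs_div, abs_of_pos this, div_le_iff₀ this]
        exact (hw i).trans (by rw [div_eq_inv_mul])
    have h := add_sum_smul_sub_mem hc hb.base_mem hy (fun i => mul_nonneg (hν i) (ha i)) hsum
    convert h using 1
    rw [hx, add_assoc, ← Finset.sum_add_distrib]
    congr 1
    refine Finset.sum_congr rfl fun i _ => ?_
    rcases eq_or_ne (ν i) 0 with h0 | h0
    · have : w i = 0 := by simpa [h0] using hw i
      simp [h0, this]
    · have h1 : w i = ν i * (w i / ν i) := by field_simp
      conv_lhs => rw [h1]
      module
  have hsub : (fun w : Fin d → ℝ => (0 : 𝔼) + ∑ i, w i • a i • (b i - b₀)) ''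
      Icc (fun i => -(ν i / d)) (fun i => ν i / d) ⊆ symCore K x := by
    rintro _ ⟨w, hw, rfl⟩
    have hw' : ∀ i, |w i| ≤ ν i / d := fun i => abs_le.2 ⟨hw.1 i, hw.2 i⟩
    refine ⟨by simpa using key w hw', ?_⟩
    have := key (fun i => -w i) (fun i => by simpa using hw' i)
    simp only [neg_smul, Finset.sum_neg_distrib, ← sub_eq_add_neg] at this
    simpa only [zero_add] using this
  have h := measureReal_mono hsub ((isCompact_symCore hK x).measure_lt_top (μ := volume)).ne
  rw [volume_real_image_sum_smul] at h
  convert h using 2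
  rw [Measure.real, Real.volume_Icc_pi_toReal]
  · rw [← Fin.prod_const, ← Finset.prod_mul_distrib]
    refine Finset.prod_congr rfl fun i _ => ?_
    ring
  · intro i
    have : 0 ≤ ν i / d := div_nonneg (hν i) (by positivity)
    simp only
    linarith

/-- The largest value, up to `1`, of the barycentric coordinate of a point at height `c` above the
base of a cap of height `t`. -/
noncomputable def cutoff (t c : ℝ) : ℝ := if c ≤ t then 1 else t / c

theorem cutoff_pos {t c : ℝ} (ht : 0 < t) : 0 < cutoff t c := by
  unfold cutoff
  split_ifs with h
  · exact one_pos
  · exact div_pos ht (ht.trans (not_le.1 h))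

theorem cutoff_le_one {t c : ℝ} (ht : 0 < t) : cutoff t c ≤ 1 := by
  unfold cutoff
  split_ifs with h
  · exact le_rfl
  · exact (div_le_one (ht.trans (not_le.1 h))).2 (not_le.1 h).le

theorem cutoff_mul_le {t c : ℝ} (ht : 0 < t) : cutoff t c * c ≤ t := by
  unfold cutoff
  split_ifs with h
  · simpa using h
  · rw [div_mul_cancel₀ _ (ht.trans (not_le.1 h)).ne']

theorem le_cutoff {t c l : ℝ} (hl1 : l ≤ 1) (hl : l * c ≤ t) (ht : 0 < t) : l ≤ cutoff t c := by
  unfold cutoff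
  split_ifs with h
  · exact hl1
  · exact (le_div_iff₀ (ht.trans (not_le.1 h))).2 hl

/-- If the cap of height `t` meets the simplex, then widening it by a constant factor makes it
contain a shrunken copy of the parallelepiped that bounds the part of the simplex in the cap. -/
theorem IsCentralSystem.spanVol_cutoff_le {K : Set 𝔼} {b₀ : 𝔼} {b : Fin d → 𝔼}
    (hb : IsCentralSystem K b₀ b) (hd : 1 ≤ d)
    (hK : IsCompact K) (hc : Convex ℝ K) {ψ : 𝔼 →L[ℝ] ℝ} {p : 𝔼} (hp : p ∈ K)
    (hmin : ∀ x ∈ K, ψ p ≤ ψ x) {t : ℝ} (ht : 0 < t)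
    (hne : (cornerSimplex b₀ b ∩ lowerCap K ψ p t).Nonempty) :
    spanVol (fun i => cutoff t (ψ (b i) - ψ p) • (b i - b₀)) ≤
      ((d : ℝ) * (d + 2)) ^ d * volume.real (lowerCap K ψ p t) := by
  have hd' : (1 : ℝ) ≤ d := by exact_mod_cast hd
  obtain ⟨x, ⟨l, hl0, hl1, rfl⟩, hxK, hxt⟩ := hne
  have hbase : ψ b₀ - ψ p ≤ (d + 1) * t := by
    have h1 : ∀ i, ψ b₀ - ψ p ≤ (d + 1) * (ψ (b i) - ψ p) := by
      intro i
      have h2 := hmin _ (hb.beyond i)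
      simp only [map_add, map_smul, map_sub, smul_eq_mul] at h2
      have h3 : (d : ℝ) * ψ p ≤ d * (ψ (b i) + (d : ℝ)⁻¹ * (ψ (b i) - ψ b₀)) :=
        mul_le_mul_of_nonneg_left h2 (by positivity)
      rw [mul_add, ← mul_assoc, mul_inv_cancel₀ (by positivity)] at h3
      linarith
    have h4 := apply_add_sum_smul_sub ψ b₀ b l (ψ p)
    have h5 : ∑ i, l i * (ψ b₀ - ψ p) ≤ ∑ i, l i * ((d + 1) * (ψ (b i) - ψ p)) :=
      Finset.sum_le_sum fun i _ => mul_le_mul_of_nonneg_left (h1 i) (hl0 i)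
    rw [← Finset.sum_mul] at h5
    have h6 : ∑ i, l i * ((d + 1) * (ψ (b i) - ψ p)) =
        (d + 1) * ∑ i, l i * (ψ (b i) - ψ p) := by
      rw [Finset.mul_sum]
      exact Finset.sum_congr rfl fun i _ => by ring
    have h7 : 0 ≤ (1 - ∑ i, l i) * (ψ b₀ - ψ p) :=
      mul_nonneg (by linarith) (by linarith [hmin _ hb.base_mem])
    have h8 : (1 - ∑ i, l i) * (ψ b₀ - ψ p) + ∑ i, l i * (ψ (b i) - ψ p) ≤ t := by linarith
    have h9 : (d + 1) * ((1 - ∑ i, l i) * (ψ b₀ - ψ p) + ∑ i, l i * (ψ (b i) - ψ p)) ≤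
        (d + 1) * t := mul_le_mul_of_nonneg_left h8 (by positivity)
    have h10 : 0 ≤ (d : ℝ) * ((1 - ∑ i, l i) * (ψ b₀ - ψ p)) := by positivity
    linarith
  have hsub : (fun ν : Fin d → ℝ => b₀ + ∑ i, ν i • cutoff t (ψ (b i) - ψ p) • (b i - b₀)) ''
      Icc (fun _ => (0 : ℝ)) (fun _ => (d : ℝ)⁻¹) ⊆ lowerCap K ψ p ((d + 2) * t) := by
    rintro _ ⟨ν, ⟨hν0, hν1⟩, rfl⟩
    simp only [smul_smul]
    have hsum1 : ∑ i, ν i ≤ 1 := by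
      refine (Finset.sum_le_sum fun i _ => hν1 i).trans ?_
      simp [mul_inv_cancel₀ (show (d : ℝ) ≠ 0 by positivity)]
    have hw0 : ∀ i, 0 ≤ ν i * cutoff t (ψ (b i) - ψ p) :=
      fun i => mul_nonneg (hν0 i) (cutoff_pos ht).le
    have hw1 : ∑ i, ν i * cutoff t (ψ (b i) - ψ p) ≤ 1 :=
      (Finset.sum_le_sum fun i _ =>
        mul_le_of_le_one_right (hν0 i) (cutoff_le_one ht)).trans hsum1
    refine ⟨add_sum_smul_sub_mem hc hb.base_mem hb.mem hw0 hw1, ?_⟩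
    have h4 := apply_add_sum_smul_sub ψ b₀ b (fun i => ν i * cutoff t (ψ (b i) - ψ p)) (ψ p)
    have h5 : ∑ i, ν i * cutoff t (ψ (b i) - ψ p) * (ψ (b i) - ψ p) ≤ ∑ i, ν i * t :=
      Finset.sum_le_sum fun i _ => by
        rw [mul_assoc]
        exact mul_le_mul_of_nonneg_left (cutoff_mul_le ht) (hν0 i)
    rw [← Finset.sum_mul] at h5
    have h6 : (∑ i, ν i) * t ≤ 1 * t := mul_le_mul_of_nonneg_right hsum1 ht.le
    have h7 : (1 - ∑ i, ν i * cutoff t (ψ (b i) - ψ p)) * (ψ b₀ - ψ p) ≤ ψ b₀ - ψ p :=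
      mul_le_of_le_one_left (by linarith [hmin _ hb.base_mem])
        (by linarith [Finset.sum_nonneg fun i (_ : i ∈ Finset.univ) => hw0 i])
    linarith
  have h := measureReal_mono hsub (volume_lowerCap_ne_top hK ψ p _)
  rw [volume_real_image_sum_smul, Measure.real, Real.volume_Icc_pi_toReal
    (fun i => by positivity)] at h
  simp only [sub_zero, Finset.prod_const, Finset.card_univ, Fintype.card_fin] at h
  have h2 := h.trans (volume_real_lowerCap_mul_le hK hc (ψ := ψ) (t := t) hp
    (show (1 : ℝ) ≤ d + 2 by linarith))
  rw [inv_pow, mul_inv_le_iff₀ (by positivity)] at h2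
  rw [mul_pow]
  linarith

/-- The part of a cap in one corner simplex where the Macbeath regions have volume at most `σ`. -/
theorem IsCentralSystem.volume_real_cornerSimplex_inter_le {K : Set 𝔼} {b₀ : 𝔼} {b : Fin d → 𝔼}
    {k : ℕ} (hdk : d = k + 1)
    (hb : IsCentralSystem K b₀ b)
    (hK : IsCompact K) (hc : Convex ℝ K) {ψ : 𝔼 →L[ℝ] ℝ} {p : 𝔼} (hp : p ∈ K)
    (hmin : ∀ x ∈ K, ψ p ≤ ψ x) {t : ℝ} (ht : 0 < t) {σ D : ℝ} (hσ : 0 < σ)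
    (hD : ((d : ℝ) * (d + 2)) ^ d * volume.real (lowerCap K ψ p t) ≤ D)
    (hσD : (d / 2) ^ d * σ ≤ D) :
    volume.real {x ∈ cornerSimplex b₀ b ∩ lowerCap K ψ p t | volume.real (symCore K x) ≤ σ} ≤
      Real.exp 1 * ((d / 2) ^ d * σ) * (1 + Real.log (D / ((d / 2) ^ d * σ))) ^ k := by
  have hd : 1 ≤ d := by omega
  have hd' : (1 : ℝ) ≤ d := by exact_mod_cast hd
  have hσ' : 0 < ((d : ℝ) / 2) ^ d * σ := by positivity
  have hlog : 0 ≤ Real.log (D / ((d / 2) ^ d * σ)) :=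
    Real.log_nonneg ((one_le_div hσ').2 hσD)
  rcases (cornerSimplex b₀ b ∩ lowerCap K ψ p t).eq_empty_or_nonempty with he | hne
  · have : {x ∈ cornerSimplex b₀ b ∩ lowerCap K ψ p t | volume.real (symCore K x) ≤ σ} = ∅ := by
      rw [he]; simp
    rw [this, measureReal_empty]
    positivity
  set g : Fin d → 𝔼 := fun i => cutoff t (ψ (b i) - ψ p) • (b i - b₀) with hg
  have hgD : spanVol g ≤ D := (hb.spanVol_cutoff_le hd hK hc hp hmin ht hne).trans hD
  -- coordinates adapted to the cap
  have hcoord : ∀ x ∈ cornerSimplex b₀ b ∩ lowerCap K ψ p t, ∃ ν : Fin d → ℝ,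
      (∀ i, 0 ≤ ν i ∧ ν i ≤ 1) ∧ x = b₀ + ∑ i, ν i • g i ∧
      spanVol g * ((2 / d) ^ d * ∏ i, ν i) ≤ volume.real (symCore K x) := by
    rintro _ ⟨⟨l, hl0, hl1, rfl⟩, hxK, hxt⟩
    have hlc : ∀ i, l i ≤ cutoff t (ψ (b i) - ψ p) := by
      intro i
      have hli : l i ≤ 1 :=
        (Finset.single_le_sum (fun j _ => hl0 j) (Finset.mem_univ i)).trans hl1
      refine le_cutoff hli ?_ ht
      have h1 := apply_add_sum_smul_sub ψ b₀ b l (ψ p)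
      have h2 : l i * (ψ (b i) - ψ p) ≤ ∑ j, l j * (ψ (b j) - ψ p) :=
        Finset.single_le_sum (f := fun j => l j * (ψ (b j) - ψ p))
          (fun j _ => mul_nonneg (hl0 j) (by linarith [hmin _ (hb.mem j)])) (Finset.mem_univ i)
      have h3 : 0 ≤ (1 - ∑ i, l i) * (ψ b₀ - ψ p) :=
        mul_nonneg (by linarith) (by linarith [hmin _ hb.base_mem])
      linarith
    have hmul : ∀ i, l i / cutoff t (ψ (b i) - ψ p) * cutoff t (ψ (b i) - ψ p) = l i :=
      fun i => div_mul_cancel₀ _ (cutoff_pos ht).ne'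
    have hν0 : ∀ i, 0 ≤ l i / cutoff t (ψ (b i) - ψ p) :=
      fun i => div_nonneg (hl0 i) (cutoff_pos ht).le
    have hxe : b₀ + ∑ i, l i • (b i - b₀) =
        b₀ + ∑ i, (l i / cutoff t (ψ (b i) - ψ p)) • g i := by
      congr 1
      refine Finset.sum_congr rfl fun i _ => ?_
      rw [hg, smul_smul, hmul]
    refine ⟨fun i => l i / cutoff t (ψ (b i) - ψ p), fun i => ⟨hν0 i, ?_⟩, hxe, ?_⟩
    · exact (div_le_one (cutoff_pos ht)).2 (hlc i)
    · rw [hxe]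
      exact hb.spanVol_mul_le hd hK hc (fun i => (cutoff_pos ht).le) hν0 (by simpa [hmul] using hl1)
  rcases (spanVol_nonneg g).eq_or_lt with h0 | hpos
  · have hsub : {x ∈ cornerSimplex b₀ b ∩ lowerCap K ψ p t | volume.real (symCore K x) ≤ σ} ⊆
        (fun ν : Fin d → ℝ => b₀ + ∑ i, ν i • g i) '' Icc 0 1 := by
      rintro x ⟨hx, -⟩
      obtain ⟨ν, h1, h2, -⟩ := hcoord x hx
      exact ⟨ν, ⟨fun i => (h1 i).1, fun i => (h1 i).2⟩, h2.symm⟩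
    have hcpt : IsCompact ((fun ν : Fin d → ℝ => b₀ + ∑ i, ν i • g i) '' Icc 0 1) :=
      isCompact_Icc.image (by fun_prop)
    refine (measureReal_mono hsub (hcpt.measure_lt_top (μ := volume)).ne).trans ?_
    rw [volume_real_image_sum_smul, ← h0, zero_mul]
    positivity
  · have hcl := isClosed_hyperbolicRegion d ((d / 2) ^ d * σ / spanVol g)
    have hsub : {x ∈ cornerSimplex b₀ b ∩ lowerCap K ψ p t | volume.real (symCore K x) ≤ σ} ⊆
        (fun ν : Fin d → ℝ => b₀ + ∑ i, ν i • g i) ''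
          hyperbolicRegion d ((d / 2) ^ d * σ / spanVol g) := by
      rintro x ⟨hx, hxσ⟩
      obtain ⟨ν, h1, h2, h3⟩ := hcoord x hx
      refine ⟨ν, ⟨h1, ?_⟩, h2.symm⟩
      rw [le_div_iff₀ hpos]
      have h4 : ((d : ℝ) / 2) ^ d * (spanVol g * ((2 / d) ^ d * ∏ i, ν i)) ≤ (d / 2) ^ d * σ :=
        mul_le_mul_of_nonneg_left (h3.trans hxσ) (by positivity)
      have h5 : ((d : ℝ) / 2) ^ d * (2 / d) ^ d = 1 := by
        rw [← mul_pow, show (d : ℝ) / 2 * (2 / d) = 1 by field_simp, one_pow]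
      calc (∏ i, ν i) * spanVol g
          = (((d : ℝ) / 2) ^ d * (2 / d) ^ d) * (spanVol g * ∏ i, ν i) := by rw [h5]; ring
        _ = ((d : ℝ) / 2) ^ d * (spanVol g * ((2 / d) ^ d * ∏ i, ν i)) := by ring
        _ ≤ _ := h4
    have hcpt : IsCompact ((fun ν : Fin d → ℝ => b₀ + ∑ i, ν i • g i) ''
        hyperbolicRegion d ((d / 2) ^ d * σ / spanVol g)) := by
      refine IsCompact.image ?_ (by fun_prop)
      exact (isCompact_Icc (a := (0 : Fin d → ℝ)) (b := 1)).of_isClosed_subset hcl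
        fun ν hν => ⟨fun i => (hν.1 i).1, fun i => (hν.1 i).2⟩
    refine (measureReal_mono hsub (hcpt.measure_lt_top (μ := volume)).ne).trans ?_
    rw [volume_real_image_sum_smul]
    have := mul_volume_real_hyperbolicRegion_le k hpos hgD hσ' hσD
    rw [← hdk] at this
    exact this

/-! ### Central points of convex bodies -/

/-- By Helly's theorem, a compact convex set has a point through which each chord is divided in a
ratio of at most `d`. -/
theorem exists_central_point {F : Set 𝔼} (hd : 1 ≤ d) (hF : IsCompact F) (hc : Convex ℝ F)
    (hne : F.Nonempty) : ∃ b ∈ F, ∀ y ∈ F, b + (d : ℝ)⁻¹ • (b - y) ∈ F := by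
  have hd' : (0 : ℝ) < d := by exact_mod_cast hd
  obtain ⟨y₀, hy₀⟩ := hne
  have hpt : ∀ (q y : 𝔼), ((d : ℝ) / (d + 1)) • q + ((1 : ℝ) / (d + 1)) • y +
      (d : ℝ)⁻¹ • (((d : ℝ) / (d + 1)) • q + ((1 : ℝ) / (d + 1)) • y - y) = q := by
    intro q y
    match_scalars <;> field_simp
    ring
  have hmemF : ∀ q ∈ F, ∀ y ∈ F, ((d : ℝ) / (d + 1)) • q + ((1 : ℝ) / (d + 1)) • y ∈ F :=
    fun q hq y hy => hc hq hy (by positivity) (by positivity) (by field_simp)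
  have hH := Convex.helly_theorem_compact' (𝕜 := ℝ)
    (F := fun y : F => (fun q : 𝔼 => ((d : ℝ) / (d + 1)) • q + ((1 : ℝ) / (d + 1)) • (y : 𝔼)) '' F)
    (fun y => ?_) (fun y => hF.image (by fun_prop)) (fun I hI => ?_)
  · obtain ⟨b, hb⟩ := hH
    rw [mem_iInter] at hb
    have hbF : b ∈ F := by
      obtain ⟨q, hq, rfl⟩ := hb ⟨y₀, hy₀⟩
      exact hmemF q hq y₀ hy₀
    refine ⟨b, hbF, fun y hy => ?_⟩
    obtain ⟨q, hq, rfl⟩ := hb ⟨y, hy⟩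
    simp only [hpt]
    exact hq
  · have := (hc.smul ((d : ℝ) / (d + 1))).translate (((1 : ℝ) / (d + 1)) • (y : 𝔼))
    rw [← image_smul, image_image] at this
    simpa only [add_comm] using this
  · rw [finrank_euclideanSpace_fin] at hI
    obtain ⟨e⟩ := Function.Embedding.nonempty_of_card_le
      (show Fintype.card I ≤ Fintype.card (Fin (d + 1)) by simpa using hI)
    -- list the points of `I`, padded to exactly `d + 1` points; their mean works
    set g : Fin (d + 1) → 𝔼 := Function.extend e (fun y => ((y : F) : 𝔼)) fun _ => y₀ with hg
    have hgF : ∀ i, g i ∈ F := by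
      intro i
      by_cases h : ∃ y, e y = i
      · obtain ⟨y, rfl⟩ := h
        rw [hg, e.injective.extend_apply]
        exact y.1.2
      · rw [hg, Function.extend_apply' _ _ _ h]
        exact hy₀
    refine ⟨((1 : ℝ) / (d + 1)) • ∑ i, g i, ?_⟩
    simp only [mem_iInter]
    intro y hy
    have hgy : g (e ⟨y, hy⟩) = y := by rw [hg, e.injective.extend_apply]
    refine ⟨∑ i ∈ Finset.univ.erase (e ⟨y, hy⟩), (d : ℝ)⁻¹ • g i,
      hc.sum_mem (fun _ _ => by positivity) ?_ fun i _ => hgF i, ?_⟩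
    · simp [hd'.ne']
    · simp only
      rw [← Finset.smul_sum, smul_smul, ← Finset.add_sum_erase _ g (Finset.mem_univ (e ⟨y, hy⟩)),
        hgy, smul_add, add_comm]
      congr 2
      field_simp

/-! ### Faces of polytopes -/

/-- The affine dimension of a set. -/
noncomputable def affDim (F : Set 𝔼) : ℕ := Module.finrank ℝ (affineSpan ℝ F).direction

theorem affDim_mono {F G : Set 𝔼} (h : F ⊆ G) : affDim F ≤ affDim G :=
  Submodule.finrank_mono (AffineSubspace.direction_le (affineSpan_mono ℝ h))

/-- A relative boundary point of a convex set, recognised by a segment that cannot be prolonged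
beyond it inside the set, lies on a supporting hyperplane that does not contain the whole set. -/
theorem exists_support {F : Set 𝔼} (hc : Convex ℝ F) {b y : 𝔼} (hb : b ∈ F)
    (hy : y ∈ F) (hexit : ∀ ε > (0 : ℝ), y + ε • (y - b) ∉ F) :
    ∃ φ : 𝔼 →L[ℝ] ℝ, (∀ x ∈ F, φ x ≤ φ y) ∧ ∃ x ∈ F, φ x < φ y := by
  set A : Set 𝔼 := (fun x => x - b) '' F with hA
  set S := Submodule.span ℝ A with hS
  set F' : Set S := (fun v : S => (v : 𝔼)) ⁻¹' A with hF'
  have hAc : Convex ℝ A := by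
    have := hc.translate (-b)
    simpa only [hA, sub_eq_neg_add] using this
  have hF'c : Convex ℝ F' := hAc.linear_preimage S.subtype
  have h0 : (0 : S) ∈ F' := ⟨b, hb, by simp⟩
  have hspan : Submodule.span ℝ F' = ⊤ := Submodule.span_span_coe_preimage
  have hint : (interior F').Nonempty := by
    rw [hF'c.interior_nonempty_iff_affineSpan_eq_top,
      AffineSubspace.affineSpan_eq_top_iff_vectorSpan_eq_top_of_nonempty ℝ S S ⟨0, h0⟩,
      vectorSpan_eq_span_vsub_set_right ℝ h0]
    simpa using hspan
  have hyS : y - b ∈ S := Submodule.subset_span ⟨y, hy, rfl⟩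
  set y' : S := ⟨y - b, hyS⟩ with hy'
  have hy'int : y' ∉ interior F' := by
    intro h
    have htend : Filter.Tendsto (fun ε : ℝ => y' + ε • y') (nhdsWithin 0 (Ioi 0)) (nhds y') := by
      have hcont : Continuous fun ε : ℝ => y' + ε • y' := by fun_prop
      have := hcont.tendsto 0
      simp only [zero_smul, add_zero] at this
      exact this.mono_left nhdsWithin_le_nhds
    have hev : ∀ᶠ ε : ℝ in nhdsWithin 0 (Ioi 0), y' + ε • y' ∈ F' :=
      htend.eventually (mem_interior_iff_mem_nhds.1 h)
    obtain ⟨ε, hε, hε0⟩ := (hev.and self_mem_nhdsWithin).exists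
    obtain ⟨x, hx, hxe⟩ := hε
    refine hexit ε hε0 ?_
    have hxe' : x - b = (y - b) + ε • (y - b) := hxe
    have : y + ε • (y - b) = x := by
      rw [sub_eq_iff_eq_add] at hxe'
      rw [hxe']; abel
    rwa [this]
  obtain ⟨f, hf0, hf⟩ := geometric_hahn_banach_of_nonempty_interior_point hF'c hy'int hint
  set φ : 𝔼 →L[ℝ] ℝ := f ∘L S.orthogonalProjectionOnto with hφ
  have hφf : ∀ x (hx : x ∈ F), φ x - φ b = f ⟨x - b, Submodule.subset_span ⟨x, hx, rfl⟩⟩ := by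
    intro x hx
    rw [← map_sub, hφ, ContinuousLinearMap.comp_apply]
    congr 1
    exact S.orthogonalProjectionOnto_mem_subspace_eq_self
      ⟨x - b, Submodule.subset_span ⟨x, hx, rfl⟩⟩
  have hle : ∀ x ∈ F, φ x ≤ φ y := by
    intro x hx
    have h1 := hf ⟨x - b, Submodule.subset_span ⟨x, hx, rfl⟩⟩ ⟨x, hx, rfl⟩
    rw [← hφf x hx, hy', ← hφf y hy] at h1
    linarith
  refine ⟨φ, hle, ?_⟩
  by_contra hcon
  push Not at hcon
  have heq : ∀ x ∈ F, φ x = φ y := fun x hx => (hle x hx).antisymm (hcon x hx)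
  refine hf0 ?_
  have hker : Submodule.span ℝ F' ≤ LinearMap.ker (f : S →ₗ[ℝ] ℝ) := by
    rw [Submodule.span_le]
    rintro v ⟨x, hx, hxv⟩
    have h1 := hφf x hx
    rw [heq x hx, heq b hb, sub_self] at h1
    have h2 : v = ⟨x - b, Submodule.subset_span ⟨x, hx, rfl⟩⟩ := Subtype.ext hxv.symm
    simp [h2, ← h1]
  ext v
  have : v ∈ LinearMap.ker (f : S →ₗ[ℝ] ℝ) := hker (hspan ▸ Submodule.mem_top)
  simpa using this

/-- The ray from `b` through `x` leaves a compact set at a last point. -/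
theorem exists_exit_point {F : Set 𝔼} (hF : IsCompact F) {b x : 𝔼} (hx : x ∈ F)
    (hne : x ≠ b) :
    ∃ y ∈ F, x ∈ segment ℝ b y ∧ ∀ ε > (0 : ℝ), y + ε • (y - b) ∉ F := by
  obtain ⟨R, hR⟩ := hF.isBounded.subset_closedBall b
  have hn : 0 < ‖x - b‖ := norm_pos_iff.2 (sub_ne_zero.2 hne)
  set T : Set ℝ := {r | b + r • (x - b) ∈ F} ∩ Icc 1 (R / ‖x - b‖) with hT
  have hbound : ∀ r : ℝ, 0 ≤ r → b + r • (x - b) ∈ F → r ≤ R / ‖x - b‖ := by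
    intro r hr hrF
    have := hR hrF
    rw [Metric.mem_closedBall, dist_eq_norm, add_sub_cancel_left, norm_smul, Real.norm_eq_abs,
      abs_of_nonneg hr] at this
    exact (le_div_iff₀ hn).2 this
  have hTc : IsCompact T := isCompact_Icc.inter_left
    (hF.isClosed.preimage (by fun_prop : Continuous fun r : ℝ => b + r • (x - b)))
  have h1T : (1 : ℝ) ∈ T := by
    have h1 : b + (1 : ℝ) • (x - b) ∈ F := by simpa using hx
    exact ⟨h1, le_rfl, hbound 1 zero_le_one h1⟩
  obtain ⟨r, ⟨hrF, hr1, -⟩, hmax⟩ := hTc.exists_isMaxOn ⟨1, h1T⟩ continuous_id.continuousOn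
  have hr0 : 0 < r := by linarith
  refine ⟨b + r • (x - b), hrF, ?_, ?_⟩
  · refine ⟨1 - r⁻¹, r⁻¹, by linarith [inv_le_one_of_one_le₀ hr1], by positivity, by ring, ?_⟩
    rw [smul_add, smul_smul, inv_mul_cancel₀ hr0.ne']
    module
  · intro ε hε hmem
    have e : b + r • (x - b) + ε • (b + r • (x - b) - b) = b + ((1 + ε) * r) • (x - b) := by module
    rw [e] at hmem
    have h1 : (1 : ℝ) ≤ (1 + ε) * r := by nlinarith
    have h2 : (1 + ε) * r ≤ r := hmax ⟨hmem, h1, hbound _ (by linarith) hmem⟩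
    nlinarith

/-- An exposed face of a polytope is the convex hull of the generating points it contains. -/
theorem IsExposed.eq_convexHull_inter {A G : Set 𝔼} (hA : A.Finite)
    (hG : IsExposed ℝ (convexHull ℝ A) G) : G = convexHull ℝ (A ∩ G) := by
  refine Subset.antisymm (fun x hx => ?_)
    (convexHull_min inter_subset_right (hG.convex (convex_convexHull ℝ A)))
  obtain ⟨l, hl⟩ := hG ⟨x, hx⟩
  have hxl : ∀ y ∈ convexHull ℝ A, l y ≤ l x := by
    rw [hl] at hx
    exact hx.2
  have hxA := hG.subset hx
  rw [hA.convexHull_eq] at hxA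
  obtain ⟨w, hw0, hw1, hwx⟩ := hxA
  rw [Finset.centerMass_eq_of_sum_1 _ _ hw1] at hwx
  simp only [id] at hwx
  -- points of positive weight lie on the face
  have hzero : ∀ a ∈ A, a ∉ G → w a = 0 := by
    have hsum : ∑ a ∈ hA.toFinset, w a * (l x - l a) = 0 := by
      simp only [mul_sub, Finset.sum_sub_distrib, ← Finset.sum_mul, hw1, one_mul]
      have := congrArg l hwx
      simp only [map_sum, map_smul, smul_eq_mul] at this
      rw [this, sub_self]
    intro a ha haG
    have hnn : ∀ a ∈ hA.toFinset, 0 ≤ w a * (l x - l a) := by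
      intro a ha
      rw [hA.mem_toFinset] at ha
      exact mul_nonneg (hw0 a ha) (sub_nonneg.2 (hxl a (subset_convexHull ℝ A ha)))
    have h1 := (Finset.sum_eq_zero_iff_of_nonneg hnn).1 hsum a (hA.mem_toFinset.2 ha)
    rcases mul_eq_zero.1 h1 with h | h
    · exact h
    · refine absurd ?_ haG
      rw [hl]
      exact ⟨subset_convexHull ℝ A ha, fun y hy => by linarith [hxl y hy]⟩
  rw [← hwx]
  have hfilter : ∑ a ∈ hA.toFinset, w a • a = ∑ a ∈ (hA.inter_of_left G).toFinset, w a • a := by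
    refine (Finset.sum_subset (fun a ha => ?_) fun a ha hna => ?_).symm
    · simp at ha ⊢; exact ha.1
    · simp at ha hna
      rw [hzero a ha (hna ha), zero_smul]
  have hfilter1 : ∑ a ∈ (hA.inter_of_left G).toFinset, w a = 1 := by
    rw [← hw1]
    refine Finset.sum_subset (fun a ha => ?_) fun a ha hna => ?_
    · simp at ha ⊢; exact ha.1
    · simp at ha hna
      exact hzero a ha (hna ha)
  rw [hfilter]
  refine (convex_convexHull ℝ (A ∩ G)).sum_mem (fun a ha => hw0 a ?_) hfilter1 fun a ha => ?_
  · simp at ha; exact ha.1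
  · exact subset_convexHull ℝ _ (by simpa using ha)

theorem finite_setOf_isExposed {A : Set 𝔼} (hA : A.Finite) :
    {G : Set 𝔼 | IsExposed ℝ (convexHull ℝ A) G}.Finite := by
  refine Set.Finite.of_finite_image (f := fun G => A ∩ G)
    (hA.finite_subsets.subset ?_) ?_
  · rintro _ ⟨G, -, rfl⟩
    exact inter_subset_left
  · intro G hG H hH h
    rw [IsExposed.eq_convexHull_inter hA hG, IsExposed.eq_convexHull_inter hA hH]
    exact congrArg (convexHull ℝ) h

/-- A face of a face of a polytope is a face. -/
theorem IsExposed.trans_convexHull {A F G : Set 𝔼} (hA : A.Finite)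
    (hF : IsExposed ℝ (convexHull ℝ A) F) (hG : IsExposed ℝ F G) :
    IsExposed ℝ (convexHull ℝ A) G := by
  rintro ⟨g, hg⟩
  obtain ⟨m, hm⟩ := hG ⟨g, hg⟩
  have hgF := hG.subset hg
  obtain ⟨l, hl⟩ := hF ⟨g, hgF⟩
  have hgl : ∀ y ∈ convexHull ℝ A, l y ≤ l g := by rw [hl] at hgF; exact hgF.2
  have hgm : ∀ y ∈ F, m y ≤ m g := by rw [hm] at hg; exact hg.2
  have hmemF : ∀ y ∈ convexHull ℝ A, l y = l g → y ∈ F := by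
    intro y hy hyl
    rw [hl]
    exact ⟨hy, fun z hz => by rw [hyl]; exact hgl z hz⟩
  obtain ⟨N, hN⟩ : ∃ N : ℝ, ∀ a ∈ A, 0 ≤ N * (l g - l a) + (m g - m a) := by
    have h : ∀ᶠ N : ℝ in Filter.atTop, ∀ a ∈ A, 0 ≤ N * (l g - l a) + (m g - m a) := by
      rw [Filter.eventually_all_finite hA]
      intro a ha
      have haA := subset_convexHull ℝ A ha
      rcases (hgl a haA).eq_or_lt with he | hlt
      · refine Filter.Eventually.of_forall fun N => ?_
        have := hgm a (hmemF a haA he)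
        rw [he, sub_self, mul_zero, zero_add]
        linarith
      · filter_upwards [Filter.eventually_ge_atTop ((m a - m g) / (l g - l a))] with N hN
        rw [div_le_iff₀ (by linarith)] at hN
        linarith
    exact h.exists
  have hN' : ∀ x ∈ convexHull ℝ A, 0 ≤ N * (l g - l x) + (m g - m x) := by
    intro x hx
    have hsub : convexHull ℝ A ⊆ {x | (N • l + m) x ≤ (N • l + m) g} := by
      refine convexHull_min (fun a ha => ?_) (convex_halfSpace_le (N • l + m).isLinear _)
      have := hN a ha
      simp
      linarith
    have := hsub hx
    simp at this
    linarith
  refine ⟨(N + 1) • l + m, ?_⟩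
  ext x
  constructor
  · intro hx
    have hxF := hG.subset hx
    have hxA := hF.subset hxF
    refine ⟨hxA, fun y hy => ?_⟩
    have h1 := hN' y hy
    have h2 := hgl y hy
    have h3 : l x = l g := by
      rw [hl] at hxF
      exact (hgl x hxA).antisymm (hxF.2 g (hF.subset hgF))
    have h4 : m x = m g := by
      rw [hm] at hx
      exact (hgm x hxF).antisymm (hx.2 g hgF)
    simp
    rw [h3, h4]
    linarith
  · rintro ⟨hxA, hx⟩
    have h1 := hN' x hxA
    have h2 := hx g (hF.subset hgF)
    have h3 := hgl x hxA
    simp at h2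
    have h4 : l x = l g := by linarith
    have hxF := hmemF x hxA h4
    rw [hm]
    refine ⟨hxF, fun y hy => (hgm y hy).trans ?_⟩
    rw [h4] at h2
    linarith

/-! ### Covering a polytope by flag simplices -/

theorem affDim_lt_of_support {F : Set 𝔼} {φ : 𝔼 →L[ℝ] ℝ} {y : 𝔼} (hy : y ∈ F)
    (hne : ∃ x ∈ F, φ x < φ y) : affDim {x ∈ F | φ x = φ y} < affDim F := by
  obtain ⟨x, hx, hxy⟩ := hne
  refine Submodule.finrank_lt_finrank_of_lt (lt_of_le_of_ne
    (AffineSubspace.direction_le (affineSpan_mono ℝ fun x hx => hx.1)) fun heq => ?_)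
  have h1 : x -ᵥ y ∈ (affineSpan ℝ F).direction :=
    AffineSubspace.vsub_mem_direction (subset_affineSpan ℝ F hx) (subset_affineSpan ℝ F hy)
  rw [← heq, direction_affineSpan, vectorSpan_def] at h1
  have h2 : Submodule.span ℝ ({x ∈ F | φ x = φ y} -ᵥ {x ∈ F | φ x = φ y}) ≤
      LinearMap.ker (φ : 𝔼 →ₗ[ℝ] ℝ) := by
    rw [Submodule.span_le]
    rintro _ ⟨u, hu, v, hv, rfl⟩
    have hu2 : φ u = φ y := hu.2
    have hv2 : φ v = φ y := hv.2
    simp [hu2, hv2]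
  have h3 : φ (x -ᵥ y) = 0 := h2 h1
  rw [vsub_eq_sub, map_sub] at h3
  linarith

/-- Each point of a face `F` of a polytope lies in the convex hull of the chosen points `b G` of a
chain of faces `G` of distinct dimensions, with `F` at the top: project from `b F` to the relative
boundary of `F` and continue with a face of smaller dimension. -/
theorem exists_chain_of_mem_face {A : Set 𝔼} (hA : A.Finite) {b : Set 𝔼 → 𝔼}
    (hb : ∀ G, IsExposed ℝ (convexHull ℝ A) G → G.Nonempty → b G ∈ G) (n : ℕ) :
    ∀ F : Set 𝔼, IsExposed ℝ (convexHull ℝ A) F → affDim F = n → ∀ x ∈ F,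
      ∃ S : Finset (Set 𝔼), F ∈ S ∧
        (∀ G ∈ S, IsExposed ℝ (convexHull ℝ A) G ∧ G.Nonempty ∧ G ⊆ F) ∧
        (∀ G ∈ S, ∀ H ∈ S, G ⊆ H ∨ H ⊆ G) ∧ Set.InjOn affDim (S : Set (Set 𝔼)) ∧
        x ∈ convexHull ℝ (b '' S) := by
  classical
  induction n using Nat.strong_induction_on with
  | _ n ih =>
  intro F hF hn x hx
  have hbF := hb F hF ⟨x, hx⟩
  by_cases hxb : x = b F
  · refine ⟨{F}, by simp, ?_, ?_, by simp, ?_⟩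
    · intro G hG
      rw [Finset.mem_singleton] at hG
      subst hG
      exact ⟨hF, ⟨x, hx⟩, Subset.rfl⟩
    · intro G hG H hH
      rw [Finset.mem_singleton] at hG hH
      subst hG; subst hH
      exact Or.inl Subset.rfl
    · simp [hxb]
  have hFc : Convex ℝ F := hF.convex (convex_convexHull ℝ A)
  have hFK : IsCompact F := hF.isCompact (hA.isCompact_convexHull (𝕜 := ℝ))
  obtain ⟨y, hyF, hxy, hexit⟩ := exists_exit_point hFK hx hxb
  obtain ⟨φ, hφ, hφne⟩ := exists_support hFc hbF hyF hexit
  set G := {z ∈ F | φ z = φ y} with hG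
  have hGF : IsExposed ℝ F G := by
    rintro -
    refine ⟨φ, ?_⟩
    ext z
    constructor
    · rintro ⟨hz, hzy⟩
      exact ⟨hz, fun w hw => by rw [hzy]; exact hφ w hw⟩
    · rintro ⟨hz, hz'⟩
      exact ⟨hz, (hφ z hz).antisymm (hz' y hyF)⟩
  have hGexp := IsExposed.trans_convexHull hA hF hGF
  have hdim : affDim G < n := hn ▸ affDim_lt_of_support hyF hφne
  obtain ⟨S, hGS, hS1, hS2, hS3, hS4⟩ := ih _ hdim G hGexp rfl y ⟨hyF, rfl⟩
  have hSF : ∀ H ∈ S, H ⊆ F := fun H hH => (hS1 H hH).2.2.trans fun z hz => hz.1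
  have hSdim : ∀ H ∈ S, affDim H < affDim F := fun H hH =>
    (affDim_mono (hS1 H hH).2.2).trans_lt (hn ▸ hdim)
  refine ⟨insert F S, by simp, ?_, ?_, ?_, ?_⟩
  · intro H hH
    rcases Finset.mem_insert.1 hH with rfl | hH
    · exact ⟨hF, ⟨x, hx⟩, Subset.rfl⟩
    · exact ⟨(hS1 H hH).1, (hS1 H hH).2.1, hSF H hH⟩
  · intro H hH H' hH'
    rcases Finset.mem_insert.1 hH with rfl | h1 <;> rcases Finset.mem_insert.1 hH' with rfl | h2
    · exact Or.inl Subset.rfl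
    · exact Or.inr (hSF _ h2)
    · exact Or.inl (hSF _ h1)
    · exact hS2 _ h1 _ h2
  · rw [Finset.coe_insert, Set.injOn_insert (fun h => (hSdim F h).ne rfl)]
    refine ⟨hS3, ?_⟩
    rintro ⟨H, hH, hHF⟩
    exact (hSdim H hH).ne hHF
  · refine (convex_convexHull ℝ _).segment_subset ?_ ?_ hxy
    · exact subset_convexHull ℝ _ ⟨F, by simp, rfl⟩
    · exact convexHull_mono (image_mono (by simp)) hS4

theorem volume_convexHull_image_eq_zero (b : Set 𝔼 → 𝔼) {S : Finset (Set 𝔼)} (hS : S.card ≤ d)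
    (hne : S.Nonempty) : volume (convexHull ℝ (b '' S)) = 0 := by
  classical
  refine measure_mono_null (convexHull_subset_affineSpan _) ?_
  refine Measure.addHaar_affineSubspace volume _ fun htop => ?_
  have h1 := finrank_vectorSpan_image_finset_le ℝ b S (n := S.card - 1)
    (by have := hne.card_pos; omega)
  rw [Finset.coe_image, ← direction_affineSpan, htop, AffineSubspace.direction_top, finrank_top,
    finrank_euclideanSpace_fin] at h1
  have := hne.card_pos
  omega

theorem convex_cornerSimplex (b₀ : 𝔼) (b : Fin d → 𝔼) : Convex ℝ (cornerSimplex b₀ b) := by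
  rintro _ ⟨l, hl0, hl1, rfl⟩ _ ⟨m, hm0, hm1, rfl⟩ r q hr hq hrq
  refine ⟨fun i => r * l i + q * m i, fun i => ?_, ?_, ?_⟩
  · exact add_nonneg (mul_nonneg hr (hl0 i)) (mul_nonneg hq (hm0 i))
  · rw [Finset.sum_add_distrib, ← Finset.mul_sum, ← Finset.mul_sum]
    nlinarith
  · simp only [add_smul, Finset.sum_add_distrib, mul_smul, ← Finset.smul_sum]
    have : q = 1 - r := by linarith
    rw [this]
    module

theorem base_mem_cornerSimplex (b₀ : 𝔼) (b : Fin d → 𝔼) : b₀ ∈ cornerSimplex b₀ b :=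
  ⟨0, fun _ => le_rfl, by simp, by simp⟩

theorem mem_cornerSimplex (b₀ : 𝔼) (b : Fin d → 𝔼) (i : Fin d) : b i ∈ cornerSimplex b₀ b := by
  refine ⟨Pi.single i 1, fun j => ?_, by simp, ?_⟩
  · by_cases h : j = i
    · subst h; simp
    · simp [h]
  · rw [Finset.sum_eq_single i (fun j _ hj => by simp [hj]) (by simp)]
    simp

/-- The simplex of a flag `F` of `P`, spanned by the chosen points of the faces of the flag and of
`P` itself. -/
def flagSimplex (P : Set 𝔼) (b : Set 𝔼 → 𝔼) (F : Fin d → Set 𝔼) : Set 𝔼 :=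
  cornerSimplex (b ((Fin.snoc F P : Fin (d + 1) → Set 𝔼) 0))
    fun i => b ((Fin.snoc F P : Fin (d + 1) → Set 𝔼) i.succ)

theorem finite_setOf_isFlag {A : Set 𝔼} (hA : A.Finite) :
    {F : Fin d → Set 𝔼 | IsFlag (convexHull ℝ A) F}.Finite := by
  refine (Set.Finite.pi' fun _ : Fin d => finite_setOf_isExposed hA).subset ?_
  intro F hF i
  exact (hF.1 i).2.1

theorem IsFlag.snoc_spec {P : Set 𝔼} (hP : P.Nonempty) {F : Fin d → Set 𝔼} (hF : IsFlag P F)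
    (i : Fin (d + 1)) :
    IsExposed ℝ P ((Fin.snoc F P : Fin (d + 1) → Set 𝔼) i) ∧
      ((Fin.snoc F P : Fin (d + 1) → Set 𝔼) i).Nonempty := by
  refine Fin.lastCases ?_ (fun i => ?_) i
  · simpa using ⟨IsExposed.refl P, hP⟩
  · simpa using ⟨(hF.1 i).2.1, (hF.1 i).1⟩

theorem IsFlag.monotone_snoc {P : Set 𝔼} {F : Fin d → Set 𝔼} (hF : IsFlag P F) :
    Monotone (Fin.snoc F P : Fin (d + 1) → Set 𝔼) := by
  intro i j hij
  induction j using Fin.lastCases with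
  | last =>
    induction i using Fin.lastCases with
    | last => exact le_rfl
    | cast i => simpa using (hF.1 i).2.1.subset
  | cast j =>
    induction i using Fin.lastCases with
    | last => exact absurd hij (not_le.2 (Fin.castSucc_lt_last j))
    | cast i => simpa using hF.2 (by simpa using hij)

/-- The simplices of the flags cover the polytope up to a null set: the chains of faces that are not
flags span only lower-dimensional simplices. -/
theorem volume_diff_iUnion_flagSimplex {A : Set 𝔼} (hA : A.Finite)
    (hfull : affDim (convexHull ℝ A) = d) {b : Set 𝔼 → 𝔼}
    (hb : ∀ G, IsExposed ℝ (convexHull ℝ A) G → G.Nonempty → b G ∈ G) :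
    volume (convexHull ℝ A \ ⋃ F ∈ {F : Fin d → Set 𝔼 | IsFlag (convexHull ℝ A) F},
      flagSimplex (convexHull ℝ A) b F) = 0 := by
  classical
  set P := convexHull ℝ A with hP
  set 𝒮 : Set (Finset (Set 𝔼)) :=
    {S | (∀ G ∈ S, IsExposed ℝ P G) ∧ S.card ≤ d ∧ S.Nonempty} with h𝒮
  have h𝒮fin : 𝒮.Finite := by
    have h1 := (finite_setOf_isExposed hA).finite_subsets
    refine Set.Finite.of_finite_image (f := fun S : Finset (Set 𝔼) => (S : Set (Set 𝔼)))
      (h1.subset ?_) (Finset.coe_injective.injOn)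
    rintro _ ⟨S, hS, rfl⟩ G hG
    exact hS.1 G hG
  have hnull : volume (⋃ S ∈ 𝒮, convexHull ℝ (b '' S)) = 0 := by
    rw [measure_biUnion_null_iff h𝒮fin.countable]
    exact fun S hS => volume_convexHull_image_eq_zero b hS.2.1 hS.2.2
  refine measure_mono_null ?_ hnull
  rintro x ⟨hxP, hx⟩
  obtain ⟨S, hPS, hS1, hS2, hS3, hS4⟩ :=
    exists_chain_of_mem_face hA hb d P (IsExposed.refl P) hfull x hxP
  by_cases hcard : S.card ≤ d
  · exact mem_biUnion (show S ∈ 𝒮 from ⟨fun G hG => (hS1 G hG).1, hcard, ⟨P, hPS⟩⟩) hS4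
  -- otherwise the chain has a face of each dimension, so it is a flag
  exfalso
  refine hx ?_
  have himg : S.image affDim = Finset.range (d + 1) := by
    refine Finset.eq_of_subset_of_card_le (fun k hk => ?_) ?_
    · obtain ⟨G, hG, rfl⟩ := Finset.mem_image.1 hk
      have := affDim_mono (hS1 G hG).2.2
      rw [Finset.mem_range]; omega
    · rw [Finset.card_range, Finset.card_image_of_injOn hS3]; omega
  have hex : ∀ i : Fin d, ∃ G ∈ S, affDim G = i := by
    intro i
    have : (i : ℕ) ∈ S.image affDim := by
      rw [himg, Finset.mem_range]; omega
    simpa using this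
  choose F hFS hFd using hex
  have hflag : IsFlag P F := by
    refine ⟨fun i => ⟨(hS1 _ (hFS i)).2.1, (hS1 _ (hFS i)).1, hFd i⟩, fun i j hij => ?_⟩
    rcases hS2 _ (hFS i) _ (hFS j) with h | h
    · exact h
    · have h1 := affDim_mono h
      rw [hFd, hFd] at h1
      have : i = j := le_antisymm hij (by exact_mod_cast h1)
      rw [this]
  refine mem_biUnion (show F ∈ {F : Fin d → Set 𝔼 | IsFlag P F} from hflag) ?_
  refine convexHull_min ?_ (convex_cornerSimplex _ _) hS4
  rintro _ ⟨G, hG, rfl⟩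
  -- each member of the chain occurs in the flag, or is the polytope itself
  obtain ⟨i, hi⟩ : ∃ i, (Fin.snoc F P : Fin (d + 1) → Set 𝔼) i = G := by
    have hGd := affDim_mono (hS1 G hG).2.2
    rw [hfull] at hGd
    rcases hGd.eq_or_lt with h | h
    · exact ⟨Fin.last d, by
        rw [Fin.snoc_last]
        exact hS3 hPS hG (by rw [hfull, h])⟩
    · exact ⟨Fin.castSucc ⟨affDim G, h⟩, by
        rw [Fin.snoc_castSucc]
        exact hS3 (hFS _) hG (by rw [hFd])⟩
  rw [← hi]
  refine Fin.cases ?_ (fun i => ?_) i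
  · exact base_mem_cornerSimplex _ _
  · exact mem_cornerSimplex _ (fun i => b ((Fin.snoc F P : Fin (d + 1) → Set 𝔼) i.succ)) i

/-! ### Counting points of disjoint systems in caps -/

theorem affDim_eq_of_volume_ne_zero {P : Set 𝔼} (h : volume P ≠ 0) : affDim P = d := by
  have htop : affineSpan ℝ P = ⊤ := by
    by_contra hne
    exact h (measure_mono_null (subset_affineSpan ℝ P)
      (Measure.addHaar_affineSubspace volume _ hne))
  rw [affDim, htop, AffineSubspace.direction_top, finrank_top, finrank_euclideanSpace_fin]

/-- The part of a cap of a polytope where the Macbeath regions have volume at most `σ`: each flag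
contributes the volume of one corner simplex. -/
theorem volume_real_cap_inter_le {k : ℕ} (hdk : d = k + 1) {A : Set 𝔼} (hA : A.Finite)
    (hvol : volume (convexHull ℝ A) ≠ 0) {ψ : 𝔼 →L[ℝ] ℝ} {p : 𝔼} (hp : p ∈ convexHull ℝ A)
    (hmin : ∀ x ∈ convexHull ℝ A, ψ p ≤ ψ x) {t : ℝ} (ht : 0 < t) {σ D : ℝ} (hσ : 0 < σ)
    (hD : ((d : ℝ) * (d + 2)) ^ d * volume.real (lowerCap (convexHull ℝ A) ψ p t) ≤ D)
    (hσD : (d / 2) ^ d * σ ≤ D) :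
    volume.real {x ∈ lowerCap (convexHull ℝ A) ψ p t |
        volume.real (symCore (convexHull ℝ A) x) ≤ σ} ≤
      numFlags (convexHull ℝ A) *
        (Real.exp 1 * ((d / 2) ^ d * σ) * (1 + Real.log (D / ((d / 2) ^ d * σ))) ^ k) := by
  classical
  have hd : 1 ≤ d := by omega
  set P := convexHull ℝ A with hP
  have hK : IsCompact P := hA.isCompact_convexHull (𝕜 := ℝ)
  have hc : Convex ℝ P := convex_convexHull ℝ A
  have hcentral : ∀ G : Set 𝔼, ∃ b : 𝔼, IsExposed ℝ P G → G.Nonempty →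
      b ∈ G ∧ ∀ y ∈ G, b + (d : ℝ)⁻¹ • (b - y) ∈ G := by
    intro G
    by_cases h : IsExposed ℝ P G ∧ G.Nonempty
    · obtain ⟨b, hb⟩ := exists_central_point hd (h.1.isCompact hK) (h.1.convex hc) h.2
      exact ⟨b, fun _ _ => hb⟩
    · exact ⟨0, fun h1 h2 => absurd ⟨h1, h2⟩ h⟩
  choose b hb using hcentral
  have hnull := volume_diff_iUnion_flagSimplex hA (affDim_eq_of_volume_ne_zero hvol)
    fun G h1 h2 => (hb G h1 h2).1
  have hfin := finite_setOf_isFlag (d := d) hA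
  set X := {x ∈ lowerCap P ψ p t | volume.real (symCore P x) ≤ σ} with hX
  have hXfin : volume X ≠ ⊤ :=
    ((measure_mono fun x hx => hx.1).trans_lt (volume_lowerCap_ne_top hK ψ p t).lt_top).ne
  have hsub : X ⊆ (P \ ⋃ F ∈ {F : Fin d → Set 𝔼 | IsFlag P F}, flagSimplex P b F) ∪
      ⋃ F ∈ hfin.toFinset, (flagSimplex P b F ∩ X) := by
    intro x hx
    by_cases h : x ∈ ⋃ F ∈ {F : Fin d → Set 𝔼 | IsFlag P F}, flagSimplex P b F
    · right
      simp only [mem_iUnion, exists_prop] at h ⊢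
      obtain ⟨F, hF, hxF⟩ := h
      exact ⟨F, hfin.mem_toFinset.2 hF, hxF, hx⟩
    · exact Or.inl ⟨hx.1.1, h⟩
  have hUfin : volume (⋃ F ∈ hfin.toFinset, (flagSimplex P b F ∩ X)) ≠ ⊤ :=
    ((measure_mono (iUnion₂_subset fun F _ => inter_subset_right)).trans_lt hXfin.lt_top).ne
  have h1 : volume.real X ≤ ∑ F ∈ hfin.toFinset, volume.real (flagSimplex P b F ∩ X) := by
    refine (measureReal_mono hsub (measure_union_lt_top (by rw [hnull]; simp)
      hUfin.lt_top).ne).trans ?_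
    refine (measureReal_union_le _ _).trans ?_
    rw [Measure.real, hnull, ENNReal.toReal_zero, zero_add]
    exact measureReal_biUnion_finset_le _ _
  refine h1.trans ?_
  have hcard : (numFlags P : ℝ) = hfin.toFinset.card := by
    rw [numFlags, ncard_eq_toFinset_card _ hfin]
  rw [hcard, ← nsmul_eq_mul]
  refine Finset.sum_le_card_nsmul _ _ _ fun F hF => ?_
  rw [hfin.mem_toFinset] at hF
  have hPne : P.Nonempty := ⟨p, hp⟩
  have hspec := IsFlag.snoc_spec hPne hF
  have hsys : IsCentralSystem P (b ((Fin.snoc F P : Fin (d + 1) → Set 𝔼) 0))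
      fun i => b ((Fin.snoc F P : Fin (d + 1) → Set 𝔼) i.succ) := by
    refine ⟨?_, fun i => ?_, fun i => ?_⟩
    · exact (hspec 0).1.subset (hb _ (hspec 0).1 (hspec 0).2).1
    · exact (hspec _).1.subset (hb _ (hspec _).1 (hspec _).2).1
    · refine (hspec i.succ).1.subset ((hb _ (hspec _).1 (hspec _).2).2 _ ?_)
      exact IsFlag.monotone_snoc hF (Fin.zero_le _) (hb _ (hspec 0).1 (hspec 0).2).1
  have h2 := hsys.volume_real_cornerSimplex_inter_le hdk hK hc hp hmin ht hσ hD hσD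
  refine le_trans (le_of_eq ?_) h2
  congr 1
  ext x
  simp only [hX, flagSimplex]
  constructor
  · rintro ⟨h1, h2, h3⟩
    exact ⟨⟨h1, h2⟩, h3⟩
  · rintro ⟨⟨h1, h2⟩, h3⟩
    exact ⟨h1, h2, h3⟩

theorem finite_and_ncard_le_of_forall_finset {α : Type*} {S : Set α} {B : ℝ}
    (h : ∀ W : Finset α, (W : Set α) ⊆ S → (W.card : ℝ) ≤ B) : S.Finite ∧ (S.ncard : ℝ) ≤ B := by
  have hfin : S.Finite := by
    by_contra hinf
    obtain ⟨W, hW, hcard⟩ := Set.Infinite.exists_subset_card_eq hinf (⌊B⌋₊ + 1)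
    have h1 := h W hW
    rw [hcard] at h1
    push_cast at h1
    linarith [Nat.lt_floor_add_one B]
  refine ⟨hfin, ?_⟩
  rw [ncard_eq_toFinset_card _ hfin]
  exact h _ (by simp)

theorem log_const_mul_le {c r : ℝ} (hc : 1 ≤ c) (hr : 2 ≤ r) :
    Real.log (c * r) ≤ (1 + Real.log c / Real.log 2) * Real.log r := by
  have h2 : 0 < Real.log 2 := Real.log_pos one_lt_two
  have h1 : Real.log 2 ≤ Real.log r := Real.log_le_log two_pos hr
  have h3 : 0 ≤ Real.log c := Real.log_nonneg hc
  rw [Real.log_mul (by linarith) (by linarith), add_mul, one_mul, div_mul_eq_mul_div]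
  have : Real.log c ≤ Real.log c * Real.log r / Real.log 2 := by
    rw [le_div_iff₀ h2]
    exact mul_le_mul_of_nonneg_left h1 h3
  linarith

/-- The Macbeath regions `M(z, 1/2)` of the points counted are disjoint, of volume at least a
constant times `s`, and contained in the doubled cap, at points whose own Macbeath regions have
volume at most a constant times `s`. -/
theorem exists_card_inter_lowerCap_le {k : ℕ} (hdk : d = k + 1) :
    ∃ c : ℝ, 0 < c ∧ ∀ A : Set 𝔼, A.Finite → volume (convexHull ℝ A) ≠ 0 →
      ∀ s : ℝ, 0 < s → ∀ Z : Set 𝔼, Z ⊆ levelSet (convexHull ℝ A) s →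
      Z.PairwiseDisjoint (fun z => macbeath (convexHull ℝ A) z (1 / 2)) →
      ∀ (ψ : 𝔼 →L[ℝ] ℝ) (p : 𝔼), p ∈ convexHull ℝ A → (∀ x ∈ convexHull ℝ A, ψ p ≤ ψ x) →
      ∀ t : ℝ, 0 < t → ∀ T : ℝ, 2 * s ≤ T →
      volume.real (lowerCap (convexHull ℝ A) ψ p t) ≤ T →
        (Z ∩ lowerCap (convexHull ℝ A) ψ p t).Finite ∧
        ((Z ∩ lowerCap (convexHull ℝ A) ψ p t).ncard : ℝ) ≤
          c * numFlags (convexHull ℝ A) * Real.log (T / s) ^ k := by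
  have hd : 1 ≤ d := by omega
  have hd' : (1 : ℝ) ≤ d := by exact_mod_cast hd
  have hm := macbeathConst_pos d
  set c₁ : ℝ := (d / 2 : ℝ) ^ d * (4 * 2 ^ d * (2 * 2 ^ d / macbeathConst d)) with hc₁
  have hc₁0 : 0 < c₁ := by positivity
  set c₂ : ℝ := ((d : ℝ) * (d + 2)) ^ d * 2 ^ d + c₁ with hc₂
  have hc₂0 : 0 < c₂ := by positivity
  have hq : 1 ≤ c₂ / c₁ := by
    rw [one_le_div hc₁0, hc₂]
    have : 0 ≤ ((d : ℝ) * (d + 2)) ^ d * 2 ^ d := by positivity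
    linarith
  have hlog2 : 0 < Real.log 2 := Real.log_pos one_lt_two
  set c₃ : ℝ := 1 / Real.log 2 + (1 + Real.log (c₂ / c₁) / Real.log 2) with hc₃
  have hc₃0 : 0 < c₃ := by
    have := Real.log_nonneg hq
    positivity
  set c₄ : ℝ := (1 / 2 : ℝ) ^ d * macbeathConst d with hc₄
  have hc₄0 : 0 < c₄ := by positivity
  refine ⟨Real.exp 1 * c₁ * c₃ ^ k / c₄, by positivity, ?_⟩
  intro A hA hvol s hs Z hZ hdisj ψ p hp hmin t ht T hT hcapT
  set P := convexHull ℝ A with hP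
  have hK : IsCompact P := hA.isCompact_convexHull (𝕜 := ℝ)
  have hc : Convex ℝ P := convex_convexHull ℝ A
  have hT0 : 0 < T := by linarith
  refine finite_and_ncard_le_of_forall_finset fun W hW => ?_
  set σ : ℝ := 4 * 2 ^ d * (2 * 2 ^ d / macbeathConst d * s) with hσ
  have hσ0 : 0 < σ := by positivity
  set X := {x ∈ lowerCap P ψ p (2 * t) | volume.real (symCore P x) ≤ σ} with hX
  have hXfin : volume X ≠ ⊤ :=
    ((measure_mono fun x hx => hx.1).trans_lt (volume_lowerCap_ne_top hK ψ p _).lt_top).ne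
  have hpos : ∀ z ∈ W, 0 < minCapVol P z := fun z hz =>
    hs.trans_le (mem_floatingBody_of_mem_levelSet hd hK (hZ (hW hz).1)).2
  have hMX : ∀ z ∈ W, macbeath P z (1 / 2) ⊆ X := by
    intro z hz x hx
    have h1 := volume_real_symCore_le_of_mem_macbeath hd hK hc (hpos z hz) hx
    have h2 := minCapVol_le_of_mem_levelSet hd hK hc hs (hZ (hW hz).1)
    have hzt := (hW hz).2.2
    obtain ⟨w, hw, rfl⟩ := hx
    refine ⟨⟨?_, ?_⟩, h1.trans ?_⟩
    · exact (smul_mem_symCore hc hw (r := 1 / 2) (by norm_num [abs_of_pos])).1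
    · have h3 := hmin _ hw.2
      simp only [map_add, map_sub, map_smul, smul_eq_mul] at h3 ⊢
      linarith
    · rw [hσ]; gcongr
  have hdisjW : (W : Set 𝔼).PairwiseDisjoint (fun z => macbeath P z (1 / 2)) :=
    hdisj.subset fun z hz => (hW hz).1
  have hsum : ∑ z ∈ W, volume.real (macbeath P z (1 / 2)) ≤ volume.real X := by
    rw [← measureReal_biUnion_finset hdisjW (fun z _ => measurableSet_macbeath hK z _)
      fun z hz => ((measure_mono (hMX z hz)).trans_lt hXfin.lt_top).ne]
    exact measureReal_mono (iUnion₂_subset hMX) hXfin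
  have hlow : W.card • (c₄ * s) ≤ ∑ z ∈ W, volume.real (macbeath P z (1 / 2)) := by
    refine Finset.card_nsmul_le_sum _ _ _ fun z hz => ?_
    rw [volume_real_macbeath, abs_of_pos (by norm_num : (0 : ℝ) < 1 / 2), hc₄, mul_assoc]
    refine mul_le_mul_of_nonneg_left ?_ (by positivity)
    refine le_trans ?_ (macbeathConst_mul_minCapVol_le hd hK hc (hpos z hz))
    exact mul_le_mul_of_nonneg_left
      (mem_floatingBody_of_mem_levelSet hd hK (hZ (hW hz).1)).2 hm.le
  have hσ' : (d / 2 : ℝ) ^ d * σ = c₁ * s := by rw [hσ, hc₁]; ring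
  have hDcap : ((d : ℝ) * (d + 2)) ^ d * volume.real (lowerCap P ψ p (2 * t)) ≤ c₂ * T := by
    have h1 := volume_real_lowerCap_mul_le hK hc (ψ := ψ) (t := t) hp
      (show (1 : ℝ) ≤ 2 by norm_num)
    have h2 : (2 : ℝ) ^ d * volume.real (lowerCap P ψ p t) ≤ 2 ^ d * T := by gcongr
    calc ((d : ℝ) * (d + 2)) ^ d * volume.real (lowerCap P ψ p (2 * t))
        ≤ ((d : ℝ) * (d + 2)) ^ d * (2 ^ d * T) := by gcongr; exact h1.trans h2
      _ ≤ c₂ * T := by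
        rw [hc₂, add_mul, mul_assoc]
        have : 0 ≤ c₁ * T := by positivity
        linarith
  have hDσ : (d / 2 : ℝ) ^ d * σ ≤ c₂ * T := by
    rw [hσ']
    exact mul_le_mul ((one_le_div hc₁0).1 hq) (by linarith) hs.le hc₂0.le
  have hmain := volume_real_cap_inter_le hdk hA hvol hp hmin (mul_pos two_pos ht) hσ0 hDcap hDσ
  rw [hσ'] at hmain
  have hr : 2 ≤ T / s := (le_div_iff₀ hs).2 hT
  have hlogle : 1 + Real.log (c₂ * T / (c₁ * s)) ≤ c₃ * Real.log (T / s) := by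
    have h1 := log_const_mul_le hq hr
    rw [div_mul_div_comm] at h1
    have h2 : 1 ≤ 1 / Real.log 2 * Real.log (T / s) := by
      rw [one_div, inv_mul_eq_div, one_le_div hlog2]
      exact Real.log_le_log two_pos hr
    have h3 : c₃ * Real.log (T / s) = 1 / Real.log 2 * Real.log (T / s) +
        (1 + Real.log (c₂ / c₁) / Real.log 2) * Real.log (T / s) := add_mul _ _ _
    linarith
  have hlog0 : 0 ≤ 1 + Real.log (c₂ * T / (c₁ * s)) := by
    have : 1 ≤ c₂ * T / (c₁ * s) := by
      rw [one_le_div (by positivity), ← hσ']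
      exact hDσ
    linarith [Real.log_nonneg this]
  have hfinal : (W.card : ℝ) * (c₄ * s) ≤
      numFlags P * (Real.exp 1 * (c₁ * s) * (c₃ * Real.log (T / s)) ^ k) := by
    rw [← nsmul_eq_mul]
    refine (hlow.trans hsum).trans (hmain.trans ?_)
    gcongr
  have hcs : 0 < c₄ * s := by positivity
  rw [← le_div_iff₀ hcs] at hfinal
  refine hfinal.trans (le_of_eq ?_)
  rw [mul_pow]
  field_simp

/-- A segment from `z` that climbs high above the base of a nearly minimal cap at `z` has a
midpoint with a large Macbeath region: that region contains a sheared copy of the one at `z`.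
Hence all points visible from `z` below the level `T` lie in a multiple of the cap. -/
theorem apply_le_of_mem_visibleRegion {K : Set 𝔼} (hd : 1 ≤ d) (hK : IsCompact K)
    (hc : Convex ℝ K) {z x : 𝔼} (hz : z ∈ K) (hv : 0 < minCapVol K z) {T : ℝ}
    (hx : x ∈ visibleRegion K z T) {ψ : 𝔼 →L[ℝ] ℝ} {p : 𝔼} (hmin : ∀ x ∈ K, ψ p ≤ ψ x)
    (hpz : ψ p < ψ z) :
    ψ x ≤ ψ p + 4 ^ d * 2 * T / (macbeathConst d * minCapVol K z) * (ψ z - ψ p) := by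
  have hm := macbeathConst_pos d
  set τ := ψ z - ψ p with hτ
  have hτ0 : 0 < τ := by linarith
  set w := (1 / 2 : ℝ) • x + (1 / 2 : ℝ) • z with hw
  have hwseg : w ∈ segment ℝ x z := ⟨1 / 2, 1 / 2, by norm_num, by norm_num, by norm_num, rfl⟩
  have hwK : w ∈ K := hc.segment_subset hx.1 hz hwseg
  have hwT : minCapVol K w < T := by
    by_contra h
    have hmem : w ∈ segment ℝ x z ∩ floatingBody K T := ⟨hwseg, hwK, not_lt.1 h⟩
    rw [hx.2] at hmem
    exact hmem
  have hshear := volume_real_image_shear (1 / 4) (τ⁻¹ • ψ) (x - z) 0 (symCore K z)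
  have hsub : (fun y => (0 : 𝔼) + (1 / 4 : ℝ) • (y + (τ⁻¹ • ψ) y • (x - z))) '' symCore K z ⊆
      symCore K w := by
    have key : ∀ y ∈ symCore K z, w + (1 / 4 : ℝ) • (y + (τ⁻¹ * ψ y) • (x - z)) ∈ K := by
      rintro y ⟨hy1, hy2⟩
      have h1 := hmin _ hy1
      have h2 := hmin _ hy2
      rw [map_add] at h1
      rw [map_sub] at h2
      set β := τ⁻¹ * ψ y with hβ
      have hβ1 : -1 ≤ β := by
        rw [hβ, le_inv_mul_iff₀ hτ0]; linarith
      have hβ2 : β ≤ 1 := by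
        rw [hβ, inv_mul_le_iff₀ hτ0]; linarith
      have h3 : (1 / 2 : ℝ) • x + (1 / 2 : ℝ) • (z + y) ∈ K :=
        hc hx.1 hy1 (by norm_num) (by norm_num) (by norm_num)
      have h4 : ((1 + β) / 2) • x + ((1 - β) / 2) • z ∈ K :=
        hc hx.1 hz (by linarith) (by linarith) (by ring)
      have h5 := hc h3 h4 (show (0 : ℝ) ≤ 1 / 2 by norm_num) (show (0 : ℝ) ≤ 1 / 2 by norm_num)
        (by norm_num)
      convert h5 using 1
      rw [hw]
      module
    rintro _ ⟨y, hy, rfl⟩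
    refine ⟨?_, ?_⟩
    · have := key y hy
      simpa using this
    · have := key (-y) (by simpa using smul_mem_symCore hc hy (r := -1) (by simp))
      convert this using 1
      simp only [smul_apply, smul_eq_mul, map_neg]
      module
  have h1 := measureReal_mono hsub ((isCompact_symCore hK w).measure_lt_top (μ := volume)).ne
  rw [hshear, abs_of_pos (by norm_num : (0 : ℝ) < 1 / 4)] at h1
  have hval : 1 + (τ⁻¹ • ψ) (x - z) = (ψ x - ψ p) / τ := by
    simp only [smul_apply, smul_eq_mul, map_sub]
    field_simp
    rw [hτ]; ring
  have hnn : 0 ≤ (ψ x - ψ p) / τ := div_nonneg (by linarith [hmin x hx.1]) hτ0.le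
  rw [hval, abs_of_nonneg hnn] at h1
  have h2 := macbeathConst_mul_minCapVol_le hd hK hc hv
  have h3 := volume_real_symCore_le hd hK w
  have h4 : (1 / 4 : ℝ) ^ d * ((ψ x - ψ p) / τ) * (macbeathConst d * minCapVol K z) ≤ 2 * T := by
    calc (1 / 4 : ℝ) ^ d * ((ψ x - ψ p) / τ) * (macbeathConst d * minCapVol K z)
        ≤ (1 / 4 : ℝ) ^ d * ((ψ x - ψ p) / τ) * volume.real (symCore K z) := by gcongr
      _ ≤ _ := h1
      _ ≤ _ := h3
      _ ≤ _ := by linarith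
  have hmv : 0 < macbeathConst d * minCapVol K z := by positivity
  rw [one_div, inv_pow, mul_assoc, inv_mul_le_iff₀ (by positivity), ← le_div_iff₀ hmv,
    div_le_iff₀ hτ0] at h4
  have h5 : (4 : ℝ) ^ d * (2 * T) = 4 ^ d * 2 * T := by ring
  rw [h5] at h4
  linarith

theorem macbeathConst_le_one (d : ℕ) : macbeathConst d ≤ 1 :=
  pow_le_one₀ (by positivity) (inv_le_one_of_one_le₀ (one_le_pow₀ (by norm_num)))

/-- The bound for visible regions follows from the one for caps, applied to a nearly minimal cap at
`z` widened by a factor proportional to `T / s`. -/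
theorem exists_card_inter_visibleRegion_le {k : ℕ} (hdk : d = k + 1) :
    ∃ c : ℝ, 0 < c ∧ ∀ A : Set 𝔼, A.Finite → volume (convexHull ℝ A) ≠ 0 →
      ∀ s : ℝ, 0 < s → ∀ Z : Set 𝔼, Z ⊆ levelSet (convexHull ℝ A) s →
      Z.PairwiseDisjoint (fun z => macbeath (convexHull ℝ A) z (1 / 2)) →
      ∀ z ∈ levelSet (convexHull ℝ A) s, ∀ T : ℝ, 2 * s ≤ T →
        (Z ∩ visibleRegion (convexHull ℝ A) z T).Finite ∧
        ((Z ∩ visibleRegion (convexHull ℝ A) z T).ncard : ℝ) ≤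
          c * numFlags (convexHull ℝ A) * Real.log (T / s) ^ k := by
  have hd : 1 ≤ d := by omega
  have hm := macbeathConst_pos d
  have hm1 := macbeathConst_le_one d
  obtain ⟨c, hc0, hmain⟩ := exists_card_inter_lowerCap_le hdk
  set a : ℝ := 4 ^ d * 2 / macbeathConst d with ha
  have ha1 : 1 ≤ a := by
    rw [ha, one_le_div hm]
    have : (1 : ℝ) ≤ 4 ^ d := one_le_pow₀ (by norm_num)
    linarith
  set e : ℝ := 2 * (2 * 2 ^ d / macbeathConst d) with he
  have he1 : 1 ≤ e := by
    rw [he, ← mul_div_assoc, one_le_div hm]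
    have : (1 : ℝ) ≤ 2 ^ d := one_le_pow₀ (by norm_num)
    linarith
  have hlog2 : 0 < Real.log 2 := Real.log_pos one_lt_two
  set q : ℝ := d * (1 + Real.log a / Real.log 2) + Real.log e / Real.log 2 with hq
  have hd' : (1 : ℝ) ≤ d := by exact_mod_cast hd
  have hq0 : 0 < q := by
    have := Real.log_nonneg ha1
    have := Real.log_nonneg he1
    positivity
  refine ⟨c * q ^ k, by positivity, ?_⟩
  intro A hA hvol s hs Z hZ hdisj z hz T hT
  set P := convexHull ℝ A with hP
  have hK : IsCompact P := hA.isCompact_convexHull (𝕜 := ℝ)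
  have hcv : Convex ℝ P := convex_convexHull ℝ A
  have hzf := mem_floatingBody_of_mem_levelSet hd hK hz
  have hv : 0 < minCapVol P z := hs.trans_le hzf.2
  obtain ⟨ψ, p, hp, hmin, hpz, hcap⟩ := exists_nearMinimal_cap hd hK hcv hv
  have hr : 2 ≤ T / s := (le_div_iff₀ hs).2 hT
  have hT0 : 0 < T := by linarith
  have har : 1 ≤ a * (T / s) := by nlinarith
  have hsub : visibleRegion P z T ⊆ lowerCap P ψ p (a * (T / s) * (ψ z - ψ p)) := by
    intro x hx
    refine ⟨hx.1, (apply_le_of_mem_visibleRegion hd hK hcv hzf.1 hv hx hmin hpz).trans ?_⟩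
    have h1 : 4 ^ d * 2 * T / (macbeathConst d * minCapVol P z) ≤ a * (T / s) := by
      rw [ha, div_mul_div_comm]
      gcongr
      exact hzf.2
    have : 0 ≤ ψ z - ψ p := by linarith
    gcongr
  have hT' : 2 * s ≤ (a * (T / s)) ^ d * (e * s) := by
    have h1 : 2 ≤ a * (T / s) := by nlinarith
    have h2 : 2 ≤ (a * (T / s)) ^ d := h1.trans (le_self_pow₀ har (by omega))
    have h3 : s ≤ e * s := le_mul_of_one_le_left hs.le he1
    exact mul_le_mul h2 h3 hs.le (by positivity)
  have hcap' : volume.real (lowerCap P ψ p (a * (T / s) * (ψ z - ψ p))) ≤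
      (a * (T / s)) ^ d * (e * s) := by
    refine (volume_real_lowerCap_mul_le hK hcv hp har).trans ?_
    have h1 := minCapVol_le_of_mem_levelSet hd hK hcv hs hz
    have h2 : volume.real (lowerCap P ψ p (ψ z - ψ p)) ≤ e * s := by rw [he]; linarith
    gcongr
  obtain ⟨hfin, hcard⟩ := hmain A hA hvol s hs Z hZ hdisj ψ p hp hmin _
    (mul_pos (by linarith) (by linarith)) _ hT' hcap'
  have hsub' : Z ∩ visibleRegion P z T ⊆ Z ∩ lowerCap P ψ p (a * (T / s) * (ψ z - ψ p)) :=
    inter_subset_inter_right Z hsub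
  refine ⟨hfin.subset hsub', ?_⟩
  have h1 : ((Z ∩ visibleRegion P z T).ncard : ℝ) ≤
      (Z ∩ lowerCap P ψ p (a * (T / s) * (ψ z - ψ p))).ncard := by
    exact_mod_cast ncard_le_ncard hsub' hfin
  refine h1.trans (hcard.trans ?_)
  have hlog : Real.log ((a * (T / s)) ^ d * (e * s) / s) ≤ q * Real.log (T / s) := by
    have e1 : ∀ y : ℝ, y * (e * s) / s = y * e := fun y => by field_simp
    rw [e1, Real.log_mul (by positivity) (by positivity), Real.log_pow]
    have h2 := mul_le_mul_of_nonneg_left (log_const_mul_le ha1 hr) (show (0 : ℝ) ≤ d by positivity)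
    have h3 : Real.log e ≤ Real.log e / Real.log 2 * Real.log (T / s) := by
      rw [div_mul_eq_mul_div, le_div_iff₀ hlog2]
      exact mul_le_mul_of_nonneg_left (Real.log_le_log two_pos hr) (Real.log_nonneg he1)
    have h4 : q * Real.log (T / s) = d * ((1 + Real.log a / Real.log 2) * Real.log (T / s)) +
        Real.log e / Real.log 2 * Real.log (T / s) := by rw [hq]; ring
    linarith
  have hlog0 : 0 ≤ Real.log ((a * (T / s)) ^ d * (e * s) / s) :=
    Real.log_nonneg ((one_le_div hs).2 (by linarith))
  calc c * numFlags P * Real.log ((a * (T / s)) ^ d * (e * s) / s) ^ k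
      ≤ c * numFlags P * (q * Real.log (T / s)) ^ k := by gcongr
    _ = c * q ^ k * numFlags P * Real.log (T / s) ^ k := by rw [mul_pow]; ring

/-- A cap of positive volume, written as a `lowerCap` of positive width. -/
theorem IsCap.exists_eq_lowerCap {K C : Set 𝔼} (hK : IsCompact K) (hc : Convex ℝ K)
    (hC : IsCap K C) (hpos : 0 < volume.real C) :
    ∃ ψ : 𝔼 →L[ℝ] ℝ, ∃ p ∈ K, (∀ x ∈ K, ψ p ≤ ψ x) ∧ ∃ t : ℝ, 0 < t ∧ C = lowerCap K ψ p t := by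
  obtain ⟨u, hu, t, ht, rfl⟩ := hC
  have hne : K.Nonempty := by
    by_contra h
    rw [not_nonempty_iff_eq_empty] at h
    simp [h] at hpos
  have hcont : Continuous fun x : 𝔼 => ⟪u, x⟫ := by fun_prop
  obtain ⟨p, hp, hsup, hmax⟩ := hK.exists_sSup_image_eq_and_ge hne hcont.continuousOn
  have hmin : ∀ x ∈ K, (-(innerSL ℝ u)) p ≤ (-(innerSL ℝ u)) x := fun x hx => by
    simpa using hmax x hx
  have hψ : -(innerSL ℝ u) ≠ 0 := by
    intro h0
    have := congrArg (fun f : 𝔼 →L[ℝ] ℝ => f u) h0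
    simp [hu] at this
  have heq : K ∩ {x | supportFn K u - t ≤ ⟪u, x⟫} = lowerCap K (-(innerSL ℝ u)) p t := by
    ext x
    refine and_congr_right fun _ => ?_
    simp only [mem_ofPred_eq, supportFn, hsup]
    simp
    constructor <;> intro h <;> linarith
  refine ⟨-(innerSL ℝ u), p, hp, hmin, t, ?_, heq⟩
  refine ht.lt_of_ne fun h0 => ?_
  -- a cap of width zero lies in the boundary of `K`
  rw [heq, ← h0] at hpos
  have h1 : lowerCap K (-(innerSL ℝ u)) p 0 ⊆ frontier K := by
    rintro x ⟨hx, hx'⟩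
    rw [hK.isClosed.frontier_eq]
    exact ⟨hx, fun hi => by linarith [lt_apply_of_mem_interior hψ hmin hi]⟩
  rw [Measure.real, measure_mono_null h1 (hc.addHaar_frontier volume), ENNReal.toReal_zero] at hpos
  exact lt_irrefl _ hpos

end

end PolytopeCaps

theorem mainTheorem4 (d : ℕ) (hd : 1 ≤ d) :
    ∃ c : ℝ, 0 < c ∧
      ∀ P : Set (EuclideanSpace ℝ (Fin d)),
        PolytopeCaps.IsPolytope P → MeasureTheory.volume P = 1 →
      ∀ s : ℝ, 0 < s → s ≤ PolytopeCaps.sZero d →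
      ∀ Z : Set (EuclideanSpace ℝ (Fin d)), PolytopeCaps.IsSaturated P s Z →
      ∀ T : ℝ, 2 * s ≤ T →
        (∀ C : Set (EuclideanSpace ℝ (Fin d)),
          PolytopeCaps.IsCap P C → MeasureTheory.volume.real C = T →
            (Z ∩ C).Finite ∧
            ((Z ∩ C).ncard : ℝ) ≤
              c * (PolytopeCaps.numFlags P : ℝ) * Real.log (T / s) ^ (d - 1)) ∧
        (∀ z ∈ PolytopeCaps.levelSet P s,
            (Z ∩ PolytopeCaps.visibleRegion P z T).Finite ∧
            ((Z ∩ PolytopeCaps.visibleRegion P z T).ncard : ℝ) ≤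
              c * (PolytopeCaps.numFlags P : ℝ) * Real.log (T / s) ^ (d - 1)) := by
  have hdk : d = (d - 1) + 1 := by omega
  obtain ⟨c₁, hc₁, h₁⟩ := PolytopeCaps.exists_card_inter_lowerCap_le hdk
  obtain ⟨c₂, hc₂, h₂⟩ := PolytopeCaps.exists_card_inter_visibleRegion_le hdk
  refine ⟨max c₁ c₂, lt_max_of_lt_left hc₁, ?_⟩
  rintro _ ⟨A, hA, rfl⟩ hvol s hs - Z hZ T hT
  have hvol0 : MeasureTheory.volume (convexHull ℝ A) ≠ 0 := by rw [hvol]; exact one_ne_zero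
  obtain ⟨hZs, hdisj⟩ := hZ.prop
  have hlog : 0 ≤ Real.log (T / s) :=
    Real.log_nonneg ((one_le_div hs).2 (by linarith))
  refine ⟨fun C hC hCT => ?_, fun z hz => ?_⟩
  · obtain ⟨ψ, p, hp, hmin, t, ht, rfl⟩ := hC.exists_eq_lowerCap
      (hA.isCompact_convexHull (𝕜 := ℝ)) (convex_convexHull ℝ A) (by linarith)
    obtain ⟨hfin, hcard⟩ := h₁ A hA hvol0 s hs Z hZs hdisj ψ p hp hmin t ht T hT hCT.le
    refine ⟨hfin, hcard.trans ?_⟩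
    gcongr
    exact le_max_left _ _
  · obtain ⟨hfin, hcard⟩ := h₂ A hA hvol0 s hs Z hZs hdisj z hz T hT
    refine ⟨hfin, hcard.trans ?_⟩
    gcongr
    exact le_max_right _ _
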